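/- **Metric uncapacitated facility location.** An instance consists of $n_f\ge 1$ facilities with opening costs $f_i\ge 0$, $n_c\ge 0$ cities, and connection costs $c_{ij}\ge 0$ between facilities $i$ and cities $j$ with $c_{ij}\le c_{ij'}+c_{i'j'}+c_{i'j}$ for all facilities $i,i'$ and cities $j,j'$ (all costs are real). A feasible solution opens a set of facilities and assigns every city to an open facility; its cost is the total opening cost of the open facilities plus the total connection cost of the assignment. $\mathrm{OPT}$ is the minimum cost of a feasible solution, and $n=\max(n_f,n_c)$. **Algorithm 2.** At time $0$ all facilities are unopened, all cities are unconnected, and $\alpha_j=0$ for every city $j$. At every moment city $j$ offers to each unopened facility $i$ the amount $\max(\alpha_j-c_{ij},0)$ if $j$ is unconnected, and $\max(c_{i'j}-c_{ij},0)$ if $j$ is currently connected to $i'$. While some city is unconnected, increase the time, and simultaneously the $\alpha_j$ of all unconnected cities $j$ at unit rate, until one of the following events occurs (events occurring at the same time are processed in an arbitrary order): (a) the total offer to some unopened facility $i$ equals $f_i$; then open $i$ and connect (or switch) to $i$ every city with a nonzero offer to $i$; (b) $\alpha_j=c_{ij}$ for some unconnected city $j$ and some open facility $i$; then connect $j$ to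 $i$. The output is the set of open facilities together with the final connections. **Theorem.** Algorithm 2 solves the metric uncapacitated facility location problem in time $O(n^3)$ with an approximation ratio between $1.598$ and $1.61$. Precisely: 1. Every execution of Algorithm 2 halts, after at most $n_f+n_c$ events, and outputs a feasible solution. 2. There are a constant $C$ and a program for a real random access machine (unit-cost addition, subtraction and comparison of natural numbers, which also serve as addresses; unit-cost addition, subtraction, multiplication, division and comparison of real numbers) that, on every instance, performs at most $C n^3$ operations and returns the output of an execution of Algorithm 2. 3. However ties between simultaneous events are broken, the approximation ratio of Algorithm 2, that is, the least $\rho$ such that on every instance the cost of the output is at most $\rho\cdot\mathrm{OPT}$, exists and satisfies $1.598\le\rho\le 1.61$. -/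

import Mathlib

/-! ## Metric uncapacitated facility location -/

namespace FacilityLocation

/-- An instance of metric uncapacitated facility location, with at least one facility. -/
structure Instance where
  /-- number of facilities -/
  nf : ℕ
  /-- number of cities -/
  nc : ℕ
  nf_pos : 0 < nf
  /-- opening costs -/
  f : Fin nf → ℝ
  /-- connection costs -/
  c : Fin nf → Fin nc → ℝ
  f_nonneg : ∀ i, 0 ≤ f i
  c_nonneg : ∀ i j, 0 ≤ c i j
  triangle : ∀ i i' j j', c i j ≤ c i j' + c i' j' + c i' j

/-- The size `n = max (n_f, n_c)` of an instance. -/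
def Instance.size (I : Instance) : ℕ := max I.nf I.nc

/-- A set of facilities to open and an assignment of the cities to facilities. -/
structure Solution (I : Instance) where
  opened : Finset (Fin I.nf)
  assign : Fin I.nc → Fin I.nf

namespace Solution

variable {I : Instance}

/-- Every city is assigned to an open facility. -/
def Feasible (s : Solution I) : Prop := ∀ j, s.assign j ∈ s.opened

/-- Total opening cost plus total connection cost. -/
def cost (s : Solution I) : ℝ := ∑ i ∈ s.opened, I.f i + ∑ j, I.c (s.assign j) j

end Solution

/-- The minimum cost of a feasible solution. -/
noncomputable def Instance.opt (I : Instance) : ℝ :=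
  sInf {x | ∃ s : Solution I, s.Feasible ∧ s.cost = x}

/-- The infimum in the definition of `opt` is attained by a feasible solution. -/
theorem Instance.isLeast_opt (I : Instance) :
    IsLeast {x | ∃ s : Solution I, s.Feasible ∧ s.cost = x} I.opt := by
  have hfin : {x | ∃ s : Solution I, s.Feasible ∧ s.cost = x}.Finite := by
    refine (Set.finite_range (fun p : Finset (Fin I.nf) × (Fin I.nc → Fin I.nf) =>
      (Solution.mk p.1 p.2 : Solution I).cost)).subset ?_
    rintro x ⟨s, -, rfl⟩
    exact ⟨(s.opened, s.assign), rfl⟩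
  have hne : {x | ∃ s : Solution I, s.Feasible ∧ s.cost = x}.Nonempty :=
    ⟨_, ⟨Finset.univ, fun _ => ⟨0, I.nf_pos⟩⟩, fun _ => Finset.mem_univ _, rfl⟩
  exact ⟨hne.csInf_mem hfin, fun _ hx => csInf_le hfin.bddBelow hx⟩

/-! ## The greedy algorithm with switching offers -/

/-- A configuration of the algorithm. -/
structure State (I : Instance) where
  /-- the current time -/
  time : ℝ
  /-- the facilities opened so far -/
  opened : Finset (Fin I.nf)
  /-- the facility a city is currently connected to (`none` if it is unconnected) -/
  conn : Fin I.nc → Option (Fin I.nf)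
  /-- the parameters `α_j` -/
  α : Fin I.nc → ℝ

namespace State

variable {I : Instance}

/-- At time `0` all facilities are unopened, all cities are unconnected and every `α_j` is `0`. -/
def init (I : Instance) : State I where
  time := 0
  opened := ∅
  conn := fun _ => none
  α := fun _ => 0

/-- Increase the time to `t`, raising `α_j` at unit rate for every unconnected city `j`. -/
def raise (s : State I) (t : ℝ) : State I where
  time := t
  opened := s.opened
  conn := s.conn
  α := fun j => if s.conn j = none then s.α j + (t - s.time) else s.α j

/-- The offer of city `j` to facility `i`: what exceeds the connection cost if `j` is unconnected,
and the saving in connection cost from switching to `i` if `j` is connected. -/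
noncomputable def offer (s : State I) (i : Fin I.nf) (j : Fin I.nc) : ℝ :=
  match s.conn j with
  | none => max (s.α j - I.c i j) 0
  | some i' => max (I.c i' j - I.c i j) 0

/-- Event (a) is due for facility `i`: it is unopened and the offers pay exactly for opening it. -/
def CanOpen (s : State I) (i : Fin I.nf) : Prop :=
  i ∉ s.opened ∧ ∑ j, s.offer i j = I.f i

/-- Event (b) is due for the unconnected city `j` and the open facility `i`. -/
def CanConnect (s : State I) (i : Fin I.nf) (j : Fin I.nc) : Prop :=
  i ∈ s.opened ∧ s.conn j = none ∧ s.α j = I.c i j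

/-- Some event is due. -/
def EventDue (s : State I) : Prop := (∃ i, s.CanOpen i) ∨ ∃ i j, s.CanConnect i j

/-- Event (a): open `i`, and connect to `i` every city, connected or not, with a nonzero offer
to `i`. -/
noncomputable def openFacility (s : State I) (i : Fin I.nf) : State I where
  time := s.time
  opened := insert i s.opened
  conn := fun j => if s.offer i j ≠ 0 then some i else s.conn j
  α := s.α

/-- Event (b): connect `j` to `i`. -/
def connect (s : State I) (i : Fin I.nf) (j : Fin I.nc) : State I where
  time := s.time
  opened := s.opened
  conn := fun j' => if j' = j then some i else s.conn j'
  α := s.α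

/-- Some city is still unconnected, and `t` is the first time, from now on, at which an event is
due. -/
def NextEventTime (s : State I) (t : ℝ) : Prop :=
  (∃ j, s.conn j = none) ∧ s.time ≤ t ∧ (s.raise t).EventDue ∧
    ∀ u, s.time ≤ u → u < t → ¬ (s.raise u).EventDue

/-- One iteration of the loop: wait for the next event and process one of the events due then.
The choice among simultaneous events is free. -/
inductive Step : State I → State I → Prop
  | openFacility {s : State I} {t : ℝ} {i : Fin I.nf} :
      s.NextEventTime t → (s.raise t).CanOpen i → Step s ((s.raise t).openFacility i)
  | connect {s : State I} {t : ℝ} {i : Fin I.nf} {j : Fin I.nc} :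
      s.NextEventTime t → (s.raise t).CanConnect i j → Step s ((s.raise t).connect i j)

/-- `Reached k s`: some execution is in configuration `s` after processing `k` events. -/
inductive Reached : ℕ → State I → Prop
  | init : Reached 0 (State.init I)
  | step {k : ℕ} {s s' : State I} : Reached k s → Step s s' → Reached (k + 1) s'

end State

/-- `IsOutput x`: some execution of the algorithm stops (all cities are connected) with `x` as its
set of open facilities and its connections. -/
def Solution.IsOutput {I : Instance} (x : Solution I) : Prop :=
  ∃ (k : ℕ) (s : State I), State.Reached k s ∧ s.opened = x.opened ∧
    ∀ j, s.conn j = some (x.assign j)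

/-- A tie-breaking rule, through its effect: for each instance, an output of an execution of the
algorithm on that instance. -/
structure TieBreaking where
  out : (I : Instance) → Solution I
  isOutput : ∀ I, (out I).IsOutput

/-- `γ` is an approximation factor for the solutions `out`. -/
def IsApproxFactor (out : (I : Instance) → Solution I) (γ : ℝ) : Prop :=
  ∀ I, (out I).cost ≤ γ * I.opt

end FacilityLocation

/-! ## A real random access machine with unit-cost operations

Memory consists of arrays of natural numbers (indices, counters) and arrays of real numbers; array
number `a` has cells `(i, j)`. A program is a finite text, so it names only finitely many arrays.
Natural numbers can be added, subtracted (truncated) and compared and used as addresses; real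
numbers can be added, subtracted, multiplied, divided and compared, and never become addresses. -/

namespace RealRAM

/-- Memory contents. -/
structure Mem where
  nats : ℕ → ℕ → ℕ → ℕ
  reals : ℕ → ℕ → ℕ → ℝ

/-- Expressions of natural number type. -/
inductive NExpr
  | const (n : ℕ)
  | get (a : ℕ) (i j : NExpr)
  | add (e₁ e₂ : NExpr)
  | sub (e₁ e₂ : NExpr)

/-- Expressions of real type. -/
inductive RExpr
  | const (n : ℕ)
  | get (a : ℕ) (i j : NExpr)
  | add (e₁ e₂ : RExpr)
  | sub (e₁ e₂ : RExpr)
  | mul (e₁ e₂ : RExpr)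
  | div (e₁ e₂ : RExpr)

/-- Tests. -/
inductive Test
  | nle (e₁ e₂ : NExpr)
  | rle (e₁ e₂ : RExpr)
  | not (b : Test)
  | and (b₁ b₂ : Test)

/-- Programs. -/
inductive Prog
  | skip
  | nset (a : ℕ) (i j : NExpr) (e : NExpr)
  | rset (a : ℕ) (i j : NExpr) (e : RExpr)
  | seq (p₁ p₂ : Prog)
  | ite (b : Test) (p₁ p₂ : Prog)
  | while (b : Test) (p : Prog)

namespace NExpr

/-- Value of an expression. -/
def eval (m : Mem) : NExpr → ℕ
  | const n => n
  | get a i j => m.nats a (i.eval m) (j.eval m)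
  | add e₁ e₂ => e₁.eval m + e₂.eval m
  | sub e₁ e₂ => e₁.eval m - e₂.eval m

/-- Number of operations needed to evaluate an expression. -/
def time : NExpr → ℕ
  | const _ => 1
  | get _ i j => i.time + j.time + 1
  | add e₁ e₂ => e₁.time + e₂.time + 1
  | sub e₁ e₂ => e₁.time + e₂.time + 1

end NExpr

namespace RExpr

/-- Value of an expression. -/
noncomputable def eval (m : Mem) : RExpr → ℝ
  | const n => n
  | get a i j => m.reals a (i.eval m) (j.eval m)
  | add e₁ e₂ => e₁.eval m + e₂.eval m
  | sub e₁ e₂ => e₁.eval m - e₂.eval m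
  | mul e₁ e₂ => e₁.eval m * e₂.eval m
  | div e₁ e₂ => e₁.eval m / e₂.eval m

/-- Number of operations needed to evaluate an expression. -/
def time : RExpr → ℕ
  | const _ => 1
  | get _ i j => i.time + j.time + 1
  | add e₁ e₂ => e₁.time + e₂.time + 1
  | sub e₁ e₂ => e₁.time + e₂.time + 1
  | mul e₁ e₂ => e₁.time + e₂.time + 1
  | div e₁ e₂ => e₁.time + e₂.time + 1

end RExpr

namespace Test

/-- Truth of a test. -/
def eval (m : Mem) : Test → Prop
  | nle e₁ e₂ => e₁.eval m ≤ e₂.eval m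
  | rle e₁ e₂ => e₁.eval m ≤ e₂.eval m
  | not b => ¬ b.eval m
  | and b₁ b₂ => b₁.eval m ∧ b₂.eval m

/-- Number of operations needed to evaluate a test. -/
def time : Test → ℕ
  | nle e₁ e₂ => e₁.time + e₂.time + 1
  | rle e₁ e₂ => e₁.time + e₂.time + 1
  | not b => b.time + 1
  | and b₁ b₂ => b₁.time + b₂.time + 1

end Test

namespace Mem

/-- Overwrite cell `(i, j)` of the array `a` of natural numbers. -/
def setNat (m : Mem) (a i j x : ℕ) : Mem where
  nats := fun a' i' j' => if a' = a ∧ i' = i ∧ j' = j then x else m.nats a' i' j'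
  reals := m.reals

/-- Overwrite cell `(i, j)` of the array `a` of real numbers. -/
def setReal (m : Mem) (a i j : ℕ) (x : ℝ) : Mem where
  nats := m.nats
  reals := fun a' i' j' => if a' = a ∧ i' = i ∧ j' = j then x else m.reals a' i' j'

end Mem

/-- `Exec p m T m'`: program `p`, started in memory `m`, halts in memory `m'` after exactly `T`
operations. -/
inductive Exec : Prog → Mem → ℕ → Mem → Prop
  | skip {m : Mem} : Exec .skip m 1 m
  | nset {m : Mem} {a : ℕ} {i j e : NExpr} :
      Exec (.nset a i j e) m (i.time + j.time + e.time + 1)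
        (m.setNat a (i.eval m) (j.eval m) (e.eval m))
  | rset {m : Mem} {a : ℕ} {i j : NExpr} {e : RExpr} :
      Exec (.rset a i j e) m (i.time + j.time + e.time + 1)
        (m.setReal a (i.eval m) (j.eval m) (e.eval m))
  | seq {p₁ p₂ : Prog} {m₁ m₂ m₃ : Mem} {T₁ T₂ : ℕ} :
      Exec p₁ m₁ T₁ m₂ → Exec p₂ m₂ T₂ m₃ → Exec (.seq p₁ p₂) m₁ (T₁ + T₂) m₃
  | iteTrue {b : Test} {p₁ p₂ : Prog} {m m' : Mem} {T : ℕ} :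
      b.eval m → Exec p₁ m T m' → Exec (.ite b p₁ p₂) m (b.time + T) m'
  | iteFalse {b : Test} {p₁ p₂ : Prog} {m m' : Mem} {T : ℕ} :
      ¬ b.eval m → Exec p₂ m T m' → Exec (.ite b p₁ p₂) m (b.time + T) m'
  | whileTrue {b : Test} {p : Prog} {m₁ m₂ m₃ : Mem} {T₁ T₂ : ℕ} :
      b.eval m₁ → Exec p m₁ T₁ m₂ → Exec (.while b p) m₂ T₂ m₃ →
        Exec (.while b p) m₁ (b.time + T₁ + T₂) m₃
  | whileFalse {b : Test} {p : Prog} {m : Mem} :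
      ¬ b.eval m → Exec (.while b p) m b.time m

end RealRAM

namespace FacilityLocation

/-- The input memory: `n_f` and `n_c` in cells `(0, 0)` and `(0, 1)` of natural number array `0`,
the opening costs in cells `(i, 0)` of real array `0`, the connection costs in cells `(i, j)` of
real array `1`, and zeros elsewhere. -/
noncomputable def Instance.load (I : Instance) : RealRAM.Mem where
  nats := fun a i j =>
    if a = 0 ∧ i = 0 ∧ j = 0 then I.nf else if a = 0 ∧ i = 0 ∧ j = 1 then I.nc else 0
  reals := fun a i j =>
    if hi : i < I.nf then
      if a = 0 ∧ j = 0 then I.f ⟨i, hi⟩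
      else if hj : a = 1 ∧ j < I.nc then I.c ⟨i, hi⟩ ⟨j, hj.2⟩
      else 0
    else 0

/-- The memory `m` holds the solution `x` as output: cell `(i, 0)` of natural number array `1` is
`1` if `i` is open and `0` if not, and cell `(j, 0)` of natural number array `2` is the facility
that city `j` is assigned to. -/
def Solution.StoredIn {I : Instance} (x : Solution I) (m : RealRAM.Mem) : Prop :=
  (∀ i : Fin I.nf, m.nats 1 i 0 = if i ∈ x.opened then 1 else 0) ∧
    ∀ j : Fin I.nc, m.nats 2 j 0 = x.assign j

/-- The program `P` implements the algorithm with at most `time n` operations on instances of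
size `n`. -/
def ImplementedBy (P : RealRAM.Prog) (time : ℕ → ℕ) : Prop :=
  ∀ I : Instance, ∃ (T : ℕ) (m : RealRAM.Mem) (x : Solution I),
    RealRAM.Exec P I.load T m ∧ T ≤ time I.size ∧ x.IsOutput ∧ x.StoredIn m

end FacilityLocation

/-! Halting: waiting makes the offers grow continuously, so a first time with an event due exists as
long as some city is unconnected. Every event opens a facility or connects a city, so there are at
most n_f + n_c events.

Upper bound: the α_j of the connected cities always pay exactly for the open facilities and the
connections, so an output costs Σ α_j. It is enough to bound Σ α_j on each star of an optimal
solution, that is, a facility of cost f with cities at distances d_j, by 1.61 (f + Σ d_j). When the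
time reaches α_i, an unopened centre has been offered at most f. A city l with α_l ≥ α_i is then
unconnected, and a city j with α_j < α_i is connected to some open φ(j), so α_l ≤ c(φ(j), l). By the
triangle inequality through the centre, j offers at least α_l − d_l − 2 d_j. These are the
factor-revealing inequalities (`State.History.sum_le`). An explicit combination of them, with the
cities sorted by α and cut into three groups, gives the factor 1.61 (`sum_le_of_factorRevealing`);
its coefficients are harmonic sums, estimated by logarithms.

Lower bound: take one star, and give each city j a private facility at the same distance d_j as the
centre, priced to open at time A_j. A city served by its private facility offers nothing to the
centre, so the centre stays unopened if the offers of the cities not yet served remain below f. The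
output costs Σ A_j against at most f + Σ d_j. All conditions are strict, so tie-breaking plays no
role. A numerical profile (A_j, d_j) makes the quotient at least 1.598 (`exists_bad_instance`). The
least factor exists because the factors form a nonempty closed set bounded below.

Running time: the offer of the unconnected cities to a facility, as a function of time, is the
maximum of 0 and of linear functions, one for each unconnected city. The next event time is
therefore a minimum over pairs (facility, city) of quantities read off from a table of sums and
counts (`State.Inv.nextEventTime_dueTime`). Finding this minimum, processing an event, and removing
one connected city from the tables each take O(n²) operations; n_f + 2 n_c such rounds suffice. -/

namespace FacilityLocation

/-! ### Invariants of an execution -/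

namespace State

variable {I : Instance}

@[simp] theorem raise_time (s : State I) (t : ℝ) : (s.raise t).time = t := rfl
@[simp] theorem raise_opened (s : State I) (t : ℝ) : (s.raise t).opened = s.opened := rfl
@[simp] theorem raise_conn (s : State I) (t : ℝ) : (s.raise t).conn = s.conn := rfl
@[simp] theorem openFacility_time (s : State I) (i : Fin I.nf) :
    (s.openFacility i).time = s.time := rfl
@[simp] theorem openFacility_α (s : State I) (i : Fin I.nf) : (s.openFacility i).α = s.α := rfl
@[simp] theorem openFacility_opened (s : State I) (i : Fin I.nf) :
    (s.openFacility i).opened = insert i s.opened := rfl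
@[simp] theorem connect_α (s : State I) (i : Fin I.nf) (j : Fin I.nc) :
    (s.connect i j).α = s.α := rfl
@[simp] theorem connect_opened (s : State I) (i : Fin I.nf) (j : Fin I.nc) :
    (s.connect i j).opened = s.opened := rfl

theorem openFacility_conn_of_offer_ne {s : State I} {i : Fin I.nf} {j : Fin I.nc}
    (h : s.offer i j ≠ 0) : (s.openFacility i).conn j = some i := if_pos h

theorem openFacility_conn_of_offer_eq {s : State I} {i : Fin I.nf} {j : Fin I.nc}
    (h : s.offer i j = 0) : (s.openFacility i).conn j = s.conn j := if_neg (not_not.2 h)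

theorem connect_conn_self (s : State I) (i : Fin I.nf) (j : Fin I.nc) :
    (s.connect i j).conn j = some i := if_pos rfl

theorem connect_conn_of_ne (s : State I) (i : Fin I.nf) {j j' : Fin I.nc} (h : j' ≠ j) :
    (s.connect i j).conn j' = s.conn j' := if_neg h

theorem raise_α_of_conn {s : State I} {j : Fin I.nc} (h : s.conn j ≠ none) (t : ℝ) :
    (s.raise t).α j = s.α j := if_neg h

theorem offer_of_none {s : State I} {j : Fin I.nc} (h : s.conn j = none) (i : Fin I.nf) :
    s.offer i j = max (s.α j - I.c i j) 0 := by simp [offer, h]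

theorem offer_of_some {s : State I} {j : Fin I.nc} {i' : Fin I.nf} (h : s.conn j = some i')
    (i : Fin I.nf) : s.offer i j = max (I.c i' j - I.c i j) 0 := by simp [offer, h]

theorem offer_nonneg (s : State I) (i : Fin I.nf) (j : Fin I.nc) : 0 ≤ s.offer i j := by
  unfold offer; split <;> exact le_max_right _ _

/-- Connection cost currently paid by a city. -/
def paid (s : State I) (j : Fin I.nc) : ℝ :=
  match s.conn j with
  | none => 0
  | some i => I.c i j

/-- The part of `α` of a city that has been spent. -/
def spent (s : State I) (j : Fin I.nc) : ℝ :=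
  match s.conn j with
  | none => 0
  | some _ => s.α j

/-- The invariant of the algorithm. -/
structure Inv (s : State I) : Prop where
  time_nonneg : 0 ≤ s.time
  mem_opened : ∀ {j i}, s.conn j = some i → i ∈ s.opened
  conn_le : ∀ {j i}, s.conn j = some i → I.c i j ≤ s.α j
  α_eq : ∀ {j}, s.conn j = none → s.α j = s.time
  α_le : ∀ j, s.α j ≤ s.time
  le_c : ∀ {j i}, s.conn j = none → i ∈ s.opened → s.time ≤ I.c i j
  offers_le : ∀ {i}, i ∉ s.opened → ∑ j, s.offer i j ≤ I.f i
  cost_eq : ∑ i ∈ s.opened, I.f i + ∑ j, s.paid j = ∑ j, s.spent j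

theorem Inv.init (I : Instance) : (State.init I).Inv where
  time_nonneg := le_rfl
  mem_opened := by simp [State.init]
  conn_le := by simp [State.init]
  α_eq := by simp [State.init]
  α_le := by simp [State.init]
  le_c := by simp [State.init]
  offers_le := by
    intro i _
    refine le_trans (le_of_eq (Finset.sum_eq_zero fun j _ => ?_)) (I.f_nonneg i)
    simp [offer, State.init, I.c_nonneg]
  cost_eq := by simp [State.init, paid, spent]

theorem Inv.raise_α {s : State I} (h : s.Inv) {j : Fin I.nc} (hj : s.conn j = none) (t : ℝ) :
    (s.raise t).α j = t := by
  simp [raise, hj, h.α_eq hj]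

theorem Inv.raise_offer_of_none {s : State I} (h : s.Inv) {j : Fin I.nc} (hj : s.conn j = none)
    (t : ℝ) (i : Fin I.nf) : (s.raise t).offer i j = max (t - I.c i j) 0 := by
  rw [offer_of_none (by simpa using hj), h.raise_α hj]

theorem raise_offer_of_some {s : State I} {j : Fin I.nc} {i' : Fin I.nf}
    (hj : s.conn j = some i') (t : ℝ) (i : Fin I.nf) :
    (s.raise t).offer i j = max (I.c i' j - I.c i j) 0 :=
  offer_of_some (s := s.raise t) (by simpa using hj) i

theorem Inv.raise_time_eq {s : State I} (h : s.Inv) : s.raise s.time = s := by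
  cases s; simp [raise]

theorem continuous_raise_offer (s : State I) (i : Fin I.nf) :
    Continuous fun t => ∑ j, (s.raise t).offer i j := by
  refine continuous_finsetSum _ fun j _ => ?_
  cases hj : s.conn j with
  | none =>
    have : (fun t => (s.raise t).offer i j)
        = fun t => max (s.α j + (t - s.time) - I.c i j) 0 := by
      funext t; rw [offer_of_none (by simpa using hj)]; simp [raise, hj]
    rw [this]; fun_prop
  | some i' =>
    have : (fun t => (s.raise t).offer i j) = fun _ => max (I.c i' j - I.c i j) 0 := by
      funext t; exact raise_offer_of_some hj t i
    rw [this]; fun_prop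

/-- The offers are continuous in time, so exceeding the opening cost at `t` would mean meeting it
exactly at an earlier time, when an event would already have been due. -/
theorem Inv.raise_offers_le {s : State I} (h : s.Inv) {t : ℝ} (ht : s.NextEventTime t)
    {i : Fin I.nf} (hi : i ∉ s.opened) : ∑ j, (s.raise t).offer i j ≤ I.f i := by
  by_contra! hlt
  have h0 : ∑ j, (s.raise s.time).offer i j ≤ I.f i := by
    rw [h.raise_time_eq]; exact h.offers_le hi
  obtain ⟨u, hu, hfu⟩ := intermediate_value_Icc ht.2.1
    (s.continuous_raise_offer i).continuousOn ⟨h0, hlt.le⟩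
  have hut : u < t := lt_of_le_of_ne hu.2 (by rintro rfl; exact hlt.ne' hfu)
  exact ht.2.2.2 u hu.1 hut (Or.inl ⟨i, hi, hfu⟩)

theorem Inv.raise_le_c {s : State I} (h : s.Inv) {t : ℝ} (ht : s.NextEventTime t)
    {i : Fin I.nf} (hi : i ∈ s.opened) {j : Fin I.nc} (hj : s.conn j = none) :
    t ≤ I.c i j := by
  by_contra! hlt
  exact ht.2.2.2 _ (h.le_c hj hi) hlt (Or.inr ⟨i, j, hi, hj, h.raise_α hj _⟩)

theorem Inv.raise {s : State I} (h : s.Inv) {t : ℝ} (ht : s.NextEventTime t) :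
    (s.raise t).Inv where
  time_nonneg := h.time_nonneg.trans ht.2.1
  mem_opened := h.mem_opened
  conn_le := by
    intro j i hj
    rw [raise_α_of_conn (by simp_all)]
    exact h.conn_le hj
  α_eq := fun hj => h.raise_α hj t
  α_le := by
    intro j
    by_cases hj : s.conn j = none
    · exact (h.raise_α hj t).le
    · rw [raise_α_of_conn hj]; exact (h.α_le j).trans ht.2.1
  le_c := fun hj hi => h.raise_le_c ht hi hj
  offers_le := fun hi => h.raise_offers_le ht hi
  cost_eq := by
    have h1 : (s.raise t).paid = s.paid := rfl
    have h2 : (s.raise t).spent = s.spent := by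
      funext j
      cases hj : s.conn j with
      | none => simp [spent, hj]
      | some i => simp [spent, hj, raise_α_of_conn (s := s) (j := j) (by simp [hj]) t]
    rw [h1, h2]; exact h.cost_eq

/-- A nonzero offer to `i` means that `i` is strictly closer than both α and any current facility.
Moving to `i` therefore can only lower the offers to the remaining facilities, and the offers
collected are exactly the opening cost, which keeps the accounts balanced. -/
theorem Inv.openFacility {s : State I} (h : s.Inv) {i : Fin I.nf} (hi : s.CanOpen i) :
    (s.openFacility i).Inv := by
  have key : ∀ j, s.offer i j ≠ 0 → I.c i j < s.α j ∧
      ∀ i', s.conn j = some i' → I.c i j < I.c i' j := by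
    intro j hj
    cases hc : s.conn j with
    | none =>
      rw [offer_of_none hc] at hj
      refine ⟨?_, by simp⟩
      by_contra! hle
      exact hj (max_eq_right (by linarith))
    | some i' =>
      rw [offer_of_some hc] at hj
      have : I.c i j < I.c i' j := by
        by_contra! hle
        exact hj (max_eq_right (by linarith))
      exact ⟨this.trans_le (h.conn_le hc), by simpa using this⟩
  refine ⟨h.time_nonneg, ?_, ?_, ?_, h.α_le, ?_, ?_, ?_⟩
  · intro j i' hj
    by_cases ho : s.offer i j = 0
    · rw [openFacility_conn_of_offer_eq ho] at hj
      exact Finset.mem_insert_of_mem (h.mem_opened hj)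
    · rw [openFacility_conn_of_offer_ne ho] at hj
      obtain rfl := Option.some.inj hj
      exact Finset.mem_insert_self _ _
  · intro j i' hj
    by_cases ho : s.offer i j = 0
    · rw [openFacility_conn_of_offer_eq ho] at hj
      exact h.conn_le hj
    · rw [openFacility_conn_of_offer_ne ho] at hj
      obtain rfl := Option.some.inj hj
      exact (key j ho).1.le
  · intro j hj
    by_cases ho : s.offer i j = 0
    · rw [openFacility_conn_of_offer_eq ho] at hj
      exact h.α_eq hj
    · simp [openFacility_conn_of_offer_ne ho] at hj
  · intro j i' hj hi'
    by_cases ho : s.offer i j = 0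
    · rw [openFacility_conn_of_offer_eq ho] at hj
      rcases Finset.mem_insert.1 hi' with rfl | hi'
      · rw [offer_of_none hj, h.α_eq hj] at ho
        have := le_max_left (s.time - I.c i' j) 0
        simp only [openFacility_time]; linarith
      · exact h.le_c hj hi'
    · simp [openFacility_conn_of_offer_ne ho] at hj
  · intro i' hi'
    have hi'' : i' ∉ s.opened := fun hm => hi' (Finset.mem_insert_of_mem hm)
    refine le_trans (Finset.sum_le_sum fun j _ => ?_) (h.offers_le hi'')
    by_cases ho : s.offer i j = 0
    · unfold offer
      rw [openFacility_conn_of_offer_eq ho]; rfl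
    · rw [offer_of_some (openFacility_conn_of_offer_ne ho)]
      obtain ⟨k1, k2⟩ := key j ho
      cases hc : s.conn j with
      | none => rw [offer_of_none hc]; exact max_le_max (by linarith) le_rfl
      | some i'' =>
        rw [offer_of_some hc]; exact max_le_max (by have := k2 _ hc; linarith) le_rfl
  · rw [openFacility_opened, Finset.sum_insert hi.1, ← hi.2]
    -- City by city, the balance paid − spent drops by the offer; the offers add up to the opening
    -- cost of `i`.
    have : ∀ j, s.offer i j + (s.openFacility i).paid j - (s.openFacility i).spent j
        = s.paid j - s.spent j := by
      intro j
      by_cases ho : s.offer i j = 0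
      · simp only [paid, spent, openFacility_conn_of_offer_eq ho, ho, openFacility_α]; ring_nf
      · simp only [paid, spent, openFacility_conn_of_offer_ne ho, openFacility_α]
        obtain ⟨k1, k2⟩ := key j ho
        cases hc : s.conn j with
        | none => rw [offer_of_none hc, max_eq_left (by linarith)]; ring
        | some i'' =>
          rw [offer_of_some hc, max_eq_left (by have := k2 _ hc; linarith)]; ring
    have h2 := Finset.sum_congr (rfl : (Finset.univ : Finset (Fin I.nc)) = _) fun j _ => this j
    rw [Finset.sum_sub_distrib, Finset.sum_sub_distrib, Finset.sum_add_distrib] at h2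
    linarith [h.cost_eq]

theorem Inv.connect {s : State I} (h : s.Inv) {i : Fin I.nf} {j : Fin I.nc}
    (hi : s.CanConnect i j) : (s.connect i j).Inv := by
  obtain ⟨hio, hjn, hα⟩ := hi
  refine ⟨h.time_nonneg, ?_, ?_, ?_, h.α_le, ?_, ?_, ?_⟩
  · intro j' i' hj
    rcases eq_or_ne j' j with rfl | hne
    · rw [connect_conn_self] at hj
      obtain rfl := Option.some.inj hj
      exact hio
    · rw [connect_conn_of_ne _ _ hne] at hj
      exact h.mem_opened hj
  · intro j' i' hj
    rcases eq_or_ne j' j with rfl | hne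
    · rw [connect_conn_self] at hj
      obtain rfl := Option.some.inj hj
      exact hα.ge
    · rw [connect_conn_of_ne _ _ hne] at hj
      exact h.conn_le hj
  · intro j' hj
    rcases eq_or_ne j' j with rfl | hne
    · simp [connect_conn_self] at hj
    · rw [connect_conn_of_ne _ _ hne] at hj
      exact h.α_eq hj
  · intro j' i' hj hi'
    rcases eq_or_ne j' j with rfl | hne
    · simp [connect_conn_self] at hj
    · rw [connect_conn_of_ne _ _ hne] at hj
      exact h.le_c hj hi'
  · intro i' hi'
    refine le_trans (Finset.sum_le_sum fun j' _ => ?_) (h.offers_le hi')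
    rcases eq_or_ne j' j with rfl | hne
    -- At the moment of connection α equals the connection cost, so the offers of the city do not
    -- change.
    · rw [offer_of_some (connect_conn_self ..), offer_of_none hjn, hα]
    · unfold offer
      rw [connect_conn_of_ne _ _ hne]; rfl
  · have : ∀ j', (s.connect i j).paid j' - (s.connect i j).spent j'
        = s.paid j' - s.spent j' := by
      intro j'
      rcases eq_or_ne j' j with rfl | hne
      · simp only [paid, spent, connect_conn_self, hjn, connect_α, hα]; ring
      · simp only [paid, spent, connect_conn_of_ne _ _ hne, connect_α]
    have h2 := Finset.sum_congr (rfl : (Finset.univ : Finset (Fin I.nc)) = _) fun j _ => this j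
    rw [Finset.sum_sub_distrib, Finset.sum_sub_distrib] at h2
    rw [connect_opened]
    linarith [h.cost_eq]

theorem Inv.step {s s' : State I} (h : s.Inv) (hs : Step s s') : s'.Inv := by
  cases hs with
  | openFacility ht hi => exact (h.raise ht).openFacility hi
  | connect ht hi => exact (h.raise ht).connect hi

theorem Reached.inv {k : ℕ} {s : State I} (h : Reached k s) : s.Inv := by
  induction h with
  | init => exact Inv.init I
  | step _ hs ih => exact ih.step hs

/-! ### Halting -/

/-- Number of open facilities plus number of connected cities. -/
def progress (s : State I) : ℕ :=
  s.opened.card + (Finset.univ.filter fun j => s.conn j ≠ none).card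

theorem progress_le (s : State I) : s.progress ≤ I.nf + I.nc :=
  Nat.add_le_add (by simpa using s.opened.card_le_univ)
    (by simpa using Finset.card_le_univ (Finset.univ.filter fun j => s.conn j ≠ none))

theorem progress_lt_openFacility {s : State I} {i : Fin I.nf} (hi : s.CanOpen i) :
    s.progress < (s.openFacility i).progress := by
  unfold progress
  rw [openFacility_opened, Finset.card_insert_of_notMem hi.1]
  have : (Finset.univ.filter fun j => s.conn j ≠ none).card ≤
      (Finset.univ.filter fun j => (s.openFacility i).conn j ≠ none).card := by
    refine Finset.card_le_card fun j => ?_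
    simp only [Finset.mem_filter, Finset.mem_univ, true_and]
    intro hj
    by_cases ho : s.offer i j = 0
    · rwa [openFacility_conn_of_offer_eq ho]
    · simp [openFacility_conn_of_offer_ne ho]
  omega

theorem progress_lt_connect {s : State I} {i : Fin I.nf} {j : Fin I.nc}
    (hi : s.CanConnect i j) : s.progress < (s.connect i j).progress := by
  unfold progress
  rw [connect_opened]
  refine Nat.add_lt_add_left (Finset.card_lt_card ?_) _
  rw [Finset.ssubset_iff_of_subset]
  · exact ⟨j, by simp [connect_conn_self], by simp [hi.2.1]⟩
  · intro j'
    simp only [Finset.mem_filter, Finset.mem_univ, true_and]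
    intro hj
    rcases eq_or_ne j' j with rfl | hne
    · simp [connect_conn_self]
    · rwa [connect_conn_of_ne _ _ hne]

theorem progress_lt_step {s s' : State I} (hs : Step s s') : s.progress < s'.progress := by
  cases hs with
  | openFacility ht hi =>
    exact lt_of_eq_of_lt (by rfl) (progress_lt_openFacility hi)
  | connect ht hi => exact lt_of_eq_of_lt (by rfl) (progress_lt_connect hi)

theorem Reached.le_progress {k : ℕ} {s : State I} (h : Reached k s) : k ≤ s.progress := by
  induction h with
  | init => exact Nat.zero_le _
  | step _ hs ih => exact ih.trans_lt (progress_lt_step hs)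

/-- Any one facility suffices. If it is open, `j` reaches it at time c; if not, `j` alone offers its
full cost at time f + c, and the intermediate value theorem provides a time of equality. -/
theorem Inv.exists_eventDue {s : State I} (h : s.Inv) (hj : ∃ j, s.conn j = none) :
    ∃ t, s.time ≤ t ∧ (s.raise t).EventDue := by
  obtain ⟨j, hj⟩ := hj
  let i : Fin I.nf := ⟨0, I.nf_pos⟩
  by_cases hi : i ∈ s.opened
  · exact ⟨I.c i j, h.le_c hj hi, Or.inr ⟨i, j, hi, hj, h.raise_α hj _⟩⟩
  · set T := max s.time (I.f i + I.c i j)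
    have h0 : ∑ j, (s.raise s.time).offer i j ≤ I.f i := by
      rw [h.raise_time_eq]; exact h.offers_le hi
    have h1 : I.f i ≤ ∑ j, (s.raise T).offer i j := by
      refine le_trans ?_ (Finset.single_le_sum
        (fun j _ => offer_nonneg (s.raise T) i j) (Finset.mem_univ j))
      rw [h.raise_offer_of_none hj]
      refine le_max_of_le_left ?_
      have := le_max_right s.time (I.f i + I.c i j)
      simp only [T]; linarith
    obtain ⟨u, hu, hfu⟩ := intermediate_value_Icc (le_max_left s.time (I.f i + I.c i j))
      (s.continuous_raise_offer i).continuousOn ⟨h0, h1⟩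
    exact ⟨u, hu.1, Or.inl ⟨i, hi, hfu⟩⟩

/-- This makes the infimum of the due times a minimum. The set is a finite union of level sets of
continuous functions and of sets with at most one point. -/
theorem Inv.isClosed_eventDue {s : State I} (h : s.Inv) :
    IsClosed {t | (s.raise t).EventDue} := by
  have : {t | (s.raise t).EventDue} =
      (⋃ i : Fin I.nf, {t | i ∉ s.opened ∧ ∑ j, (s.raise t).offer i j = I.f i}) ∪
        ⋃ i : Fin I.nf, ⋃ j : Fin I.nc, {t | i ∈ s.opened ∧ s.conn j = none ∧ t = I.c i j} := by
    ext t
    simp only [EventDue, CanOpen, CanConnect, raise_opened, raise_conn, Set.mem_ofPred_eq,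
      Set.mem_union, Set.mem_iUnion]
    refine or_congr_right (exists_congr fun i => exists_congr fun j => and_congr_right fun _ =>
      and_congr_right fun hj => ?_)
    rw [h.raise_α hj]
  rw [this]
  refine IsClosed.union (isClosed_iUnion_of_finite fun i => ?_)
    (isClosed_iUnion_of_finite fun i => isClosed_iUnion_of_finite fun j => ?_)
  · exact isClosed_const.and (isClosed_eq (s.continuous_raise_offer i) continuous_const)
  · exact isClosed_const.and (isClosed_const.and (isClosed_eq continuous_id continuous_const))

theorem Inv.exists_nextEventTime {s : State I} (h : s.Inv) (hj : ∃ j, s.conn j = none) :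
    ∃ t, s.NextEventTime t := by
  obtain ⟨T, hT⟩ := h.exists_eventDue hj
  set E := Set.Ici s.time ∩ {t | (s.raise t).EventDue}
  have hcl : IsClosed E := isClosed_Ici.inter h.isClosed_eventDue
  have hbdd : BddBelow E := ⟨s.time, fun _ hx => hx.1⟩
  have hmem := hcl.csInf_mem ⟨T, hT⟩ hbdd
  exact ⟨sInf E, hj, hmem.1, hmem.2, fun u hu hlt hd => hlt.not_ge (csInf_le hbdd ⟨hu, hd⟩)⟩

theorem Inv.exists_step {s : State I} (h : s.Inv) (hj : ∃ j, s.conn j = none) :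
    ∃ s', Step s s' := by
  obtain ⟨t, ht⟩ := h.exists_nextEventTime hj
  rcases ht.2.2.1 with ⟨i, hi⟩ | ⟨i, j, hij⟩
  · exact ⟨_, Step.openFacility ht hi⟩
  · exact ⟨_, Step.connect ht hij⟩

end State

theorem Solution.IsOutput.feasible {I : Instance} {x : Solution I} (h : x.IsOutput) :
    x.Feasible := by
  obtain ⟨k, s, hs, ho, hc⟩ := h
  intro j
  rw [← ho]
  exact hs.inv.mem_opened (hc j)

/-- The cost of an output is the sum of the final `α_j`. -/
theorem Solution.cost_eq_sum_α {I : Instance} {x : Solution I} {s : State I} (hs : s.Inv)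
    (ho : s.opened = x.opened) (hc : ∀ j, s.conn j = some (x.assign j)) :
    x.cost = ∑ j, s.α j := by
  have h := hs.cost_eq
  have h1 : s.paid = fun j => I.c (x.assign j) j := by funext j; simp [State.paid, hc]
  have h2 : s.spent = s.α := by funext j; simp [State.spent, hc]
  rw [h1, h2, ho] at h
  exact h

end FacilityLocation

/-! ### What the past of an execution says about α -/

namespace FacilityLocation

namespace State

variable {I : Instance}

/-- What the execution up to now says about the parameters `α`. The field `snap` records, for
every facility `i₀` and every city `i`, the situation just after the time reached `α i`. -/
structure History (s : State I) : Prop where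
  snap : ∀ (i₀ : Fin I.nf) (i : Fin I.nc),
    (i₀ ∈ s.opened ∧ ∀ l, s.α i ≤ s.α l → s.α l ≤ I.c i₀ l) ∨
    ∃ φ : Fin I.nc → Fin I.nf,
      (∀ j, s.α j < s.α i → φ j ∈ s.opened ∧ ∀ l, s.α i ≤ s.α l → s.α l ≤ I.c (φ j) l) ∧
      ∑ j, (if s.α j < s.α i then max (I.c (φ j) j - I.c i₀ j) 0
        else max (s.α i - I.c i₀ j) 0) ≤ I.f i₀
  first : ∀ i, s.conn i ≠ none → ∃ i' ∈ s.opened, I.c i' i ≤ s.α i ∧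
    ∀ l, s.α i < s.α l → s.α l ≤ I.c i' l

theorem History.init (I : Instance) : (State.init I).History where
  snap := by
    intro i₀ i
    refine Or.inr ⟨fun _ => i₀, by simp [State.init], ?_⟩
    refine le_trans (le_of_eq (Finset.sum_eq_zero fun j _ => ?_)) (I.f_nonneg i₀)
    simp [State.init, I.c_nonneg]
  first := by simp [State.init]

/-- New snapshots are taken only when the time strictly increases to `t`. At that instant the cities
with α < t are exactly the connected ones and all others have α = t, so `snap` is the bound on the
offers with φ the current connection. Cities tied with `i` thus count as unconnected, in whatever
order the events at time `t` are processed. Old snapshots survive since comparisons with a connected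
city do not change (`hltc`) and α of an unconnected city is still at most its distance to any open
facility (`hopen`). -/
theorem History.raise {s : State I} (h : s.History) (hi : s.Inv) {t : ℝ}
    (ht : s.NextEventTime t) : (s.raise t).History := by
  rcases ht.2.1.eq_or_lt with rfl | hlt
  · rwa [hi.raise_time_eq]
  have hc : ∀ {j}, s.conn j ≠ none → (s.raise t).α j = s.α j := fun hj => raise_α_of_conn hj t
  have hn : ∀ {j}, s.conn j = none → (s.raise t).α j = t := fun hj => hi.raise_α hj t
  have hopen : ∀ {i l}, i ∈ s.opened → (s.conn l ≠ none → s.α l ≤ I.c i l) →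
      (s.raise t).α l ≤ I.c i l := by
    intro i l hio hl
    by_cases hln : s.conn l = none
    · rw [hn hln]; exact hi.raise_le_c ht hio hln
    · rw [hc hln]; exact hl hln
  have hltc : ∀ {j i}, s.conn i ≠ none → ((s.raise t).α j < (s.raise t).α i ↔ s.α j < s.α i) := by
    intro j i hic
    rw [hc hic]
    by_cases hjn : s.conn j = none
    · rw [hn hjn, hi.α_eq hjn]
      exact iff_of_false ((hi.α_le i).trans hlt.le).not_gt (hi.α_le i).not_gt
    · rw [hc hjn]
  refine ⟨fun i₀ i => ?_, fun i hic => ?_⟩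
  · by_cases hin : s.conn i = none
    · by_cases hio : i₀ ∈ s.opened
      · refine Or.inl ⟨hio, fun l hl => hopen hio fun hln => ?_⟩
        rw [hn hin, hc hln] at hl
        exact absurd (hi.α_le l) (hlt.trans_le hl).not_ge
      · have hcn : ∀ {j}, (s.raise t).α j < t → s.conn j ≠ none :=
          fun hj hjn => hj.ne (hn hjn)
        have hoff := hi.raise_offers_le ht hio
        refine Or.inr ⟨fun j => (s.conn j).getD i₀, fun j hj => ?_, ?_⟩
        · rw [hn hin] at hj
          obtain ⟨i', hi'⟩ := Option.ne_none_iff_exists'.1 (hcn hj)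
          simp only [hi', Option.getD_some]
          have hm := hi.mem_opened hi'
          refine ⟨hm, fun l hl => hopen hm fun hln => ?_⟩
          rw [hn hin, hc hln] at hl
          exact absurd (hi.α_le l) (hlt.trans_le hl).not_ge
        · refine le_trans (le_of_eq (Finset.sum_congr rfl fun j _ => ?_)) hoff
          rw [hn hin]
          by_cases hjn : s.conn j = none
          · rw [hn hjn, if_neg (lt_irrefl _), hi.raise_offer_of_none hjn]
          · obtain ⟨i', hi'⟩ := Option.ne_none_iff_exists'.1 hjn
            rw [hc hjn, if_pos ((hi.α_le j).trans_lt hlt), raise_offer_of_some hi']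
            simp only [hi', Option.getD_some]
    · rcases h.snap i₀ i with ⟨hio, hl⟩ | ⟨φ, hφ, hsum⟩
      · refine Or.inl ⟨hio, fun l hle => hopen hio fun hln => hl l ?_⟩
        rwa [hc hin, hc hln] at hle
      · refine Or.inr ⟨φ, fun j hj => ?_, ?_⟩
        · obtain ⟨h1, h2⟩ := hφ j ((hltc hin).1 hj)
          refine ⟨h1, fun l hle => hopen h1 fun hln => h2 l ?_⟩
          rwa [hc hin, hc hln] at hle
        · refine le_trans (le_of_eq (Finset.sum_congr rfl fun j _ => ?_)) hsum
          have h5 := hltc (j := j) hin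
          rw [hc hin] at h5 ⊢
          simp only [h5]
  · obtain ⟨i', h1, h2, h3⟩ := h.first i hic
    refine ⟨i', h1, by rwa [hc hic], fun l hl => hopen h1 fun hln => h3 l ?_⟩
    rwa [hc hic, hc hln] at hl

/-- `snap` involves only α, which is unchanged, and the open set, which grows. A newly connected
city has the largest α so far, so the last clause of `first` is vacuous for it. -/
theorem History.openFacility {s : State I} (h : s.History) (hi : s.Inv) {i : Fin I.nf}
    (ho : s.CanOpen i) : (s.openFacility i).History := by
  refine ⟨fun i₀ j => ?_, fun j hj => ?_⟩
  · rcases h.snap i₀ j with ⟨h1, h2⟩ | ⟨φ, hφ, hsum⟩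
    · exact Or.inl ⟨Finset.mem_insert_of_mem h1, h2⟩
    · exact Or.inr ⟨φ, fun j' hj' => ⟨Finset.mem_insert_of_mem (hφ j' hj').1, (hφ j' hj').2⟩, hsum⟩
  · by_cases hjn : s.conn j = none
    · have hof : s.offer i j ≠ 0 := by
        intro h0
        rw [openFacility_conn_of_offer_eq h0] at hj
        exact hj hjn
      refine ⟨i, Finset.mem_insert_self _ _,
        (hi.openFacility ho).conn_le (openFacility_conn_of_offer_ne hof), fun l hl => ?_⟩
      simp only [openFacility_α, hi.α_eq hjn] at hl
      exact absurd (hi.α_le l) hl.not_ge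
    · obtain ⟨i', h1, h2⟩ := h.first j hjn
      exact ⟨i', Finset.mem_insert_of_mem h1, h2⟩

theorem History.connect {s : State I} (h : s.History) (hi : s.Inv) {i : Fin I.nf}
    {j : Fin I.nc} (ho : s.CanConnect i j) : (s.connect i j).History := by
  refine ⟨h.snap, fun j' hj => ?_⟩
  by_cases hjn : s.conn j' = none
  · have hjj : j' = j := by
      by_contra hne
      rw [connect_conn_of_ne _ _ hne] at hj
      exact hj hjn
    subst hjj
    refine ⟨i, ho.1, ho.2.2.ge, fun l hl => ?_⟩
    simp only [connect_α, hi.α_eq hjn] at hl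
    exact absurd (hi.α_le l) hl.not_ge
  · exact h.first j' hjn

theorem Reached.history {k : ℕ} {s : State I} (h : Reached k s) : s.History := by
  induction h with
  | init => exact History.init I
  | step hr hs ih =>
    have hi := hr.inv
    cases hs with
    | openFacility ht ho => exact (ih.raise hi ht).openFacility (hi.raise ht) ho
    | connect ht ho => exact (ih.raise hi ht).connect (hi.raise ht) ho

/-- For an earlier city `j`, the triangle inequality gives c(φ j, j) ≥ c(φ j, l) − c(i₀, l) − c(i₀,
j), and c(φ j, l) ≥ α l because φ j was open while `l` was unconnected. If `i₀` was itself open,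
every summand is nonpositive. -/
theorem History.sum_le {s : State I} (h : s.History) (i₀ : Fin I.nf) {i l : Fin I.nc}
    (hil : s.α i ≤ s.α l) :
    ∑ j, (if s.α j < s.α i then max (s.α l - I.c i₀ l - 2 * I.c i₀ j) 0
      else max (s.α i - I.c i₀ j) 0) ≤ I.f i₀ := by
  rcases h.snap i₀ i with ⟨-, h2⟩ | ⟨φ, hφ, hsum⟩
  · refine le_trans (Finset.sum_nonpos fun j _ => ?_) (I.f_nonneg i₀)
    split_ifs with hj
    · exact max_le (by linarith [h2 l hil, I.c_nonneg i₀ j]) le_rfl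
    · have hj := not_lt.1 hj
      exact max_le (by linarith [h2 j hj]) le_rfl
  · refine le_trans (Finset.sum_le_sum fun j _ => ?_) hsum
    split_ifs with hj
    · refine max_le_max ?_ le_rfl
      have h1 := (hφ j hj).2 l hil
      have h2 := I.triangle (φ j) i₀ l j
      linarith
    · exact le_rfl

/-- A later city `l` was unconnected while a facility `i'` near `i` was open, so α l ≤ c(i', l); the
detour i', i, i₀, l bounds this. It is what settles ties in `State.History.sum_α_le`. -/
theorem History.α_le {s : State I} (h : s.History) (hc : ∀ j, s.conn j ≠ none)
    (i₀ : Fin I.nf) (i l : Fin I.nc) : s.α l ≤ s.α i + I.c i₀ i + I.c i₀ l := by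
  rcases lt_or_ge (s.α i) (s.α l) with hlt | hle
  · obtain ⟨i', -, h1, h2⟩ := h.first i (hc i)
    have h3 := h2 l hlt
    have h4 := I.triangle i' i₀ l i
    linarith
  · linarith [I.c_nonneg i₀ i, I.c_nonneg i₀ l]

end State

/-! ### The factor-revealing program -/

/-- Telescoping of 1 − 1/x ≤ log x; the reverse estimate below telescopes log x ≤ x − 1 instead. -/
theorem sum_inv_sub_le_log (b : ℕ) {a : ℕ} (h : a < b) :
    ∑ i ∈ Finset.range a, 1 / ((b : ℝ) - i) ≤ Real.log b - Real.log (b - a) := by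
  induction a with
  | zero => simp
  | succ a ih =>
    rw [Finset.sum_range_succ]
    have h1 : (0 : ℝ) < b - (a + 1 : ℕ) := by
      rw [sub_pos]; exact_mod_cast h
    have h2 : (0 : ℝ) < b - a := by push_cast at h1; linarith
    have h3 := Real.one_sub_inv_le_log_of_pos (div_pos h2 h1)
    rw [Real.log_div h2.ne' h1.ne', inv_div] at h3
    have h4 : 1 - ((b : ℝ) - (a + 1 : ℕ)) / (b - a) = 1 / (b - a) := by
      field_simp; push_cast; ring
    have := ih (by omega)
    linarith

theorem log_le_sum_inv_sub (b : ℕ) {a : ℕ} (h : a ≤ b) :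
    Real.log (b + 1) - Real.log (b + 1 - a) ≤ ∑ i ∈ Finset.range a, 1 / ((b : ℝ) - i) := by
  induction a with
  | zero => simp
  | succ a ih =>
    rw [Finset.sum_range_succ]
    have h1 : (0 : ℝ) < b - a := by
      rw [sub_pos]; exact_mod_cast h
    have h2 : (0 : ℝ) < b + 1 - a := by linarith
    have h3 := Real.log_le_sub_one_of_pos (div_pos h2 h1)
    rw [Real.log_div h2.ne' h1.ne'] at h3
    have h4 : ((b : ℝ) + 1 - a) / (b - a) - 1 = 1 / (b - a) := by
      field_simp; ring
    have h5 : (b : ℝ) + 1 - (a + 1 : ℕ) = b - a := by push_cast; ring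
    rw [h5]
    have := ih (by omega)
    linarith

/-- With the cuts a = 43960 m, b = 69540 m and K = 100000 m, the first two arguments are b / (b − a)
and (K − a) / (K − b). The last two are (b + 1) / (b − a + 1) and (K − a + 1) / (K − b + 1) for m =
1, the worst case. -/
theorem log_bounds :
    Real.log (6954 / 2558) ≤ 1.0001 ∧ Real.log (5604 / 3046) ≤ 0.6097 ∧
      1 ≤ Real.log (69541 / 25581) ∧ 0.6096 ≤ Real.log (56041 / 30461) := by
  refine ⟨?_, ?_, ?_, ?_⟩
  · rw [Real.log_le_iff_le_exp (by norm_num)]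
    refine le_trans ?_ (Real.sum_le_exp_of_nonneg (by norm_num) 10)
    norm_num [Finset.sum_range_succ, Nat.factorial]
  · rw [Real.log_le_iff_le_exp (by norm_num)]
    refine le_trans ?_ (Real.sum_le_exp_of_nonneg (by norm_num) 10)
    norm_num [Finset.sum_range_succ, Nat.factorial]
  · rw [Real.le_log_iff_exp_le (by norm_num)]
    exact Real.exp_one_lt_d9.le.trans (by norm_num)
  · rw [Real.le_log_iff_exp_le (by norm_num)]
    refine (Real.exp_bound' (by norm_num) (by norm_num) (n := 10) (by norm_num)).trans ?_
    norm_num [Finset.sum_range_succ, Nat.factorial]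

/-- The factor-revealing inequalities bound the ratio by `1.61`. -/
theorem sum_le_of_factorRevealing {m : ℕ} (hm : 0 < m) {α d : ℕ → ℝ} {f : ℝ} (hf : 0 ≤ f)
    (hd : ∀ j, 0 ≤ d j)
    (h : ∀ i l, i ≤ l → l < 100000 * m →
      ∑ j ∈ Finset.range i, max (α l - d l - 2 * d j) 0 +
        ∑ j ∈ Finset.Ico i (100000 * m), max (α i - d j) 0 ≤ f) :
    ∑ i ∈ Finset.range (100000 * m), α i ≤
      1.61 * (f + ∑ i ∈ Finset.range (100000 * m), d i) := by
  obtain ⟨K, hK⟩ : ∃ K, K = 100000 * m := ⟨_, rfl⟩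
  -- The cuts make log (b / (b − a)) about 1 and log ((K − a) / (K − b)) about 0.6097, while the
  -- total coefficient of `s` below is still nonpositive.
  obtain ⟨a, ha⟩ : ∃ a, a = 43960 * m := ⟨_, rfl⟩
  obtain ⟨b, hb⟩ : ∃ b, b = 69540 * m := ⟨_, rfl⟩
  rw [← hK] at h ⊢
  have hm' : (1 : ℝ) ≤ m := by exact_mod_cast hm
  have hKr : (K : ℝ) = 100000 * m := by rw [hK]; push_cast; ring
  have har : (a : ℝ) = 43960 * m := by rw [ha]; push_cast; ring
  have hbr : (b : ℝ) = 69540 * m := by rw [hb]; push_cast; ring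
  have hab : a < b := by omega
  have hbK : b < K := by omega
  set D : ℕ → ℝ := fun n => ∑ j ∈ Finset.range n, d j with hD
  -- the largest `α l - d l` over the late cities
  obtain ⟨s, hs0, hs1, hs2⟩ : ∃ s : ℝ, 0 ≤ s ∧ (∀ l, b ≤ l → l < K → α l ≤ s + d l) ∧
      ∀ i < b, ∑ j ∈ Finset.range i, max (s - 2 * d j) 0 +
        ∑ j ∈ Finset.Ico i K, max (α i - d j) 0 ≤ f := by
    obtain ⟨l, hl, hmax⟩ := Finset.exists_max_image (Finset.Ico b K) (fun l => α l - d l)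
      ⟨b, by simp [hbK]⟩
    rw [Finset.mem_Ico] at hl
    refine ⟨max (α l - d l) 0, le_max_right _ _, fun l' h1 h2 => ?_, fun i hi => ?_⟩
    · have := hmax l' (by simp [h1, h2])
      have h3 := le_max_left (α l - d l) 0
      linarith
    · refine le_trans (add_le_add (Finset.sum_le_sum fun j _ => ?_) le_rfl)
        (h i l (by omega) hl.2)
      rcases le_total (α l - d l) 0 with h0 | h0
      · rw [max_eq_right h0]
        exact max_le (le_max_of_le_right (by linarith [hd j])) (le_max_right _ _)
      · rw [max_eq_left h0]
  have key : ∀ i < b, ∀ n, i < n → n ≤ K →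
      α i ≤ 1 / ((n : ℝ) - i) * (f + D n) - i / ((n : ℝ) - i) * (s / 2) := by
    intro i hi n hin hnK
    have hpos : (0 : ℝ) < n - i := by rw [sub_pos]; exact_mod_cast hin
    -- This is max x 0 ≥ x / 2, which leaves each early distance with coefficient 1, the same as
    -- that of the distances in the second sum.
    have h1 : ∑ j ∈ Finset.range i, (s / 2 - d j) ≤
        ∑ j ∈ Finset.range i, max (s - 2 * d j) 0 := by
      refine Finset.sum_le_sum fun j _ => ?_
      have h3 := le_max_left (s - 2 * d j) 0
      have h4 := le_max_right (s - 2 * d j) 0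
      linarith
    have h2 : ∑ j ∈ Finset.Ico i n, (α i - d j) ≤ ∑ j ∈ Finset.Ico i K, max (α i - d j) 0 := by
      refine le_trans (Finset.sum_le_sum fun j _ => le_max_left _ 0) ?_
      exact Finset.sum_le_sum_of_subset_of_nonneg (Finset.Ico_subset_Ico le_rfl hnK)
        fun _ _ _ => le_max_right _ _
    have h3 := hs2 i hi
    have h4 : D i + ∑ j ∈ Finset.Ico i n, d j = D n := Finset.sum_range_add_sum_Ico _ hin.le
    simp only [Finset.sum_sub_distrib, Finset.sum_const, Finset.card_range, nsmul_eq_mul,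
      Nat.card_Ico, Nat.cast_sub hin.le] at h1 h2
    have h5 : ((n : ℝ) - i) * α i ≤ f + D n - i * (s / 2) := by
      have : D i = ∑ j ∈ Finset.range i, d j := rfl
      linarith
    have h6 : 1 / ((n : ℝ) - i) * (f + D n) - i / ((n : ℝ) - i) * (s / 2)
        = (f + D n - i * (s / 2)) / ((n : ℝ) - i) := by ring
    rw [h6, le_div_iff₀ hpos]
    linarith
  set Θ₁ := ∑ i ∈ Finset.range a, 1 / ((b : ℝ) - i) with hΘ₁
  set Θ₂ := ∑ i ∈ Finset.Ico a b, 1 / ((K : ℝ) - i) with hΘ₂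
  have e : ∀ n i : ℕ, i < n → (i : ℝ) / ((n : ℝ) - i) = n * (1 / ((n : ℝ) - i)) - 1 := by
    intro n i hin
    have hpos : (0 : ℝ) < n - i := by rw [sub_pos]; exact_mod_cast hin
    field_simp; ring
  -- Stopping at n = b charges the first group to D b alone. Together with the −D b of `s3` this
  -- leaves the coefficient Θ₁ − 1, so Θ₁ has to be close to 1.
  have s1 : ∑ i ∈ Finset.range a, α i ≤ Θ₁ * (f + D b) - (b * Θ₁ - a) * (s / 2) := by
    have : ∑ i ∈ Finset.range a, (i : ℝ) / ((b : ℝ) - i) = b * Θ₁ - a := by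
      rw [hΘ₁, Finset.mul_sum, Finset.sum_congr rfl fun i hi =>
        e b i ((Finset.mem_range.1 hi).trans hab), Finset.sum_sub_distrib]
      simp
    rw [← this, hΘ₁, Finset.sum_mul, Finset.sum_mul, ← Finset.sum_sub_distrib]
    refine Finset.sum_le_sum fun i hi => ?_
    have hi := Finset.mem_range.1 hi
    exact key i (hi.trans hab) b (hi.trans hab) hbK.le
  have s2 : ∑ i ∈ Finset.Ico a b, α i ≤
      Θ₂ * (f + D K) - (K * Θ₂ - (b - a)) * (s / 2) := by
    have : ∑ i ∈ Finset.Ico a b, (i : ℝ) / ((K : ℝ) - i) = K * Θ₂ - (b - a) := by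
      rw [hΘ₂, Finset.mul_sum, Finset.sum_congr rfl fun i hi =>
        e K i ((Finset.mem_Ico.1 hi).2.trans hbK), Finset.sum_sub_distrib]
      simp [Nat.cast_sub hab.le]
    rw [← this, hΘ₂, Finset.sum_mul, Finset.sum_mul, ← Finset.sum_sub_distrib]
    refine Finset.sum_le_sum fun i hi => ?_
    have hi := Finset.mem_Ico.1 hi
    exact key i hi.2 K (hi.2.trans hbK) le_rfl
  have s3 : ∑ i ∈ Finset.Ico b K, α i ≤ (K - b) * s + (D K - D b) := by
    have : ∑ i ∈ Finset.Ico b K, (s + d i) = (K - b) * s + (D K - D b) := by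
      have h1 : D b + ∑ j ∈ Finset.Ico b K, d j = D K := Finset.sum_range_add_sum_Ico d hbK.le
      rw [Finset.sum_add_distrib, ← h1]
      simp [Nat.cast_sub hbK.le]
    rw [← this]
    refine Finset.sum_le_sum fun i hi => ?_
    have hi := Finset.mem_Ico.1 hi
    exact hs1 i hi.1 hi.2
  have hsplit : ∑ i ∈ Finset.range K, α i = ∑ i ∈ Finset.range a, α i +
      ∑ i ∈ Finset.Ico a b, α i + ∑ i ∈ Finset.Ico b K, α i := by
    rw [Finset.sum_range_add_sum_Ico _ hab.le, Finset.sum_range_add_sum_Ico _ hbK.le]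
  obtain ⟨l1, l2, l3, l4⟩ := log_bounds
  have u1 : Θ₁ ≤ 1.0001 := by
    refine (sum_inv_sub_le_log b hab).trans (le_trans (le_of_eq ?_) l1)
    rw [← Real.log_div (by rw [hbr]; positivity) (by rw [hbr, har]; linarith), hbr, har]
    congr 1
    field_simp; ring
  have hΘ₂' : Θ₂ = ∑ i ∈ Finset.range (b - a), 1 / (((K - a : ℕ) : ℝ) - i) := by
    rw [hΘ₂, Finset.sum_Ico_eq_sum_range]
    refine Finset.sum_congr rfl fun i _ => ?_
    rw [Nat.cast_sub (by omega)]; push_cast; ring_nf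
  have u2 : Θ₂ ≤ 0.6097 := by
    rw [hΘ₂']
    refine (sum_inv_sub_le_log (K - a) (by omega)).trans (le_trans (le_of_eq ?_) l2)
    rw [Nat.cast_sub (by omega), Nat.cast_sub hab.le, hKr, har, hbr,
      ← Real.log_div (by linarith) (by linarith)]
    congr 1
    have : (m : ℝ) ≠ 0 := by linarith
    rw [show (100000 * m - 43960 * m - (69540 * m - 43960 * m) : ℝ) = 30460 * m by ring,
      show (100000 * m - 43960 * m : ℝ) = 56040 * m by ring]
    field_simp; norm_num
  have v1 : 1 ≤ Θ₁ := by
    refine l3.trans (le_trans ?_ (log_le_sum_inv_sub b hab.le))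
    rw [hbr, har, ← Real.log_div (by linarith) (by linarith)]
    refine Real.log_le_log (by norm_num) ?_
    rw [div_le_div_iff₀ (by norm_num) (by linarith)]
    linarith
  have v2 : 0.6096 ≤ Θ₂ := by
    rw [hΘ₂']
    refine l4.trans (le_trans ?_ (log_le_sum_inv_sub (K - a) (by omega)))
    rw [Nat.cast_sub (by omega), Nat.cast_sub hab.le, hKr, har, hbr,
      ← Real.log_div (by linarith) (by linarith)]
    refine Real.log_le_log (by norm_num) ?_
    rw [div_le_div_iff₀ (by norm_num) (by linarith)]
    linarith
  have hDb : 0 ≤ D b := Finset.sum_nonneg fun j _ => hd j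
  have hDK : D b ≤ D K := Finset.sum_le_sum_of_subset_of_nonneg
    (Finset.range_subset_range.2 hbK.le) fun j _ _ => hd j
  -- The gains in `s1` and `s2` absorb the (K − b) s lost in `s3`. Then f has coefficient at most
  -- 1.0001 + 0.6097, and D K at most 0.0001 + 0.6097 + 1.
  have hcoef : 2 * ((K : ℝ) - b) ≤ (b * Θ₁ - a) + (K * Θ₂ - (b - a)) := by
    have h1 : (b : ℝ) * 1 ≤ b * Θ₁ := mul_le_mul_of_nonneg_left v1 (by positivity)
    have h2 : (K : ℝ) * 0.6096 ≤ K * Θ₂ := mul_le_mul_of_nonneg_left v2 (by positivity)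
    linarith
  have t1 : 2 * ((K : ℝ) - b) * (s / 2) ≤
      ((b * Θ₁ - a) + (K * Θ₂ - (b - a))) * (s / 2) :=
    mul_le_mul_of_nonneg_right hcoef (by linarith)
  have t2 : (Θ₁ - 1) * D b ≤ 0.0001 * D K :=
    mul_le_mul (by linarith) hDK hDb (by norm_num)
  have t3 : Θ₁ * f ≤ 1.0001 * f := mul_le_mul_of_nonneg_right u1 hf
  have t4 : Θ₂ * (f + D K) ≤ 0.6097 * (f + D K) :=
    mul_le_mul_of_nonneg_right u2 (by linarith)
  have hDK' : ∑ i ∈ Finset.range K, d i = D K := rfl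
  rw [hsplit, hDK']
  linarith

theorem sum_range_mul_div (M k : ℕ) (hM : 0 < M) (F : ℕ → ℝ) :
    ∑ i ∈ Finset.range (M * k), F (i / M) = M * ∑ i ∈ Finset.range k, F i := by
  induction k with
  | zero => simp
  | succ k ih =>
    rw [Nat.mul_succ, Finset.sum_range_add, ih, Finset.sum_range_succ, mul_add]
    congr 1
    rw [Finset.sum_congr rfl fun i hi => by
      rw [Nat.mul_add_div hM, Nat.div_eq_of_lt (Finset.mem_range.1 hi), add_zero]]
    simp

/-- Dual fitting for one facility and a set of cities. -/
theorem State.History.sum_α_le {I : Instance} {s : State I} (h : s.History)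
    (hc : ∀ j, s.conn j ≠ none) (i₀ : Fin I.nf) (S : Finset (Fin I.nc)) (hS : S.Nonempty) :
    ∑ j ∈ S, s.α j ≤ 1.61 * (I.f i₀ + ∑ j ∈ S, I.c i₀ j) := by
  classical
  obtain ⟨k, hk⟩ : ∃ k, k = S.card := ⟨_, rfl⟩
  have hk0 : 0 < k := by rw [hk]; exact hS.card_pos
  have hks : Fintype.card S = k := by simp [hk]
  let e₀ : Fin k ≃ S := (Fintype.equivFinOfCardEq hks).symm
  let e : Fin k ≃ S := (Tuple.sort fun x => s.α (e₀ x)).trans e₀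
  have hmono : Monotone fun x => s.α (e x) := Tuple.monotone_sort fun x => s.α (e₀ x)
  -- The cities of `S` in order of α; indices beyond the end repeat the last city.
  let g : ℕ → Fin I.nc := fun r => e ⟨min r (k - 1), by omega⟩
  have hg : ∀ x : Fin k, g x = e x := by
    intro x
    have : min (x : ℕ) (k - 1) = x := by omega
    simp only [g, this]
  have hgm : ∀ {p q}, p ≤ q → s.α (g p) ≤ s.α (g q) := by
    intro p q hpq
    exact hmono (show (⟨min p (k - 1), _⟩ : Fin k) ≤ ⟨min q (k - 1), _⟩ from
      Fin.mk_le_mk.2 (min_le_min_right _ hpq))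
  have hsum : ∀ F : Fin I.nc → ℝ, ∑ r ∈ Finset.range k, F (g r) = ∑ j ∈ S, F j := by
    intro F
    rw [Finset.sum_range, Finset.sum_congr rfl fun x _ => by rw [hg x],
      Equiv.sum_comp e fun x => F x, Finset.sum_coe_sort S F]
  have hM : 0 < 100000 := by norm_num
  -- Every city is replaced by 100000 copies and the opening cost is scaled alike, so that the two
  -- cuts fall on integers.
  have main := sum_le_of_factorRevealing hk0 (α := fun i => s.α (g (i / 100000)))
    (d := fun i => I.c i₀ (g (i / 100000))) (f := 100000 * I.f i₀)
    (mul_nonneg (by norm_num) (I.f_nonneg i₀)) (fun j => I.c_nonneg _ _) ?_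
  · rw [sum_range_mul_div _ _ hM fun r => s.α (g r),
      sum_range_mul_div _ _ hM fun r => I.c i₀ (g r), hsum, hsum (I.c i₀)] at main
    push_cast at main
    linarith
  · intro i l hil hl
    set p := g (i / 100000)
    set q := g (l / 100000)
    have hpq : s.α p ≤ s.α q := hgm (Nat.div_le_div_right hil)
    let F : Fin I.nc → ℝ := fun r => if s.α r < s.α p then max (s.α q - I.c i₀ q - 2 * I.c i₀ r) 0
      else max (s.α p - I.c i₀ r) 0
    have hF0 : ∀ r, 0 ≤ F r := by
      intro r; simp only [F]; split_ifs <;> exact le_max_right _ _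
    have h1 : ∑ r ∈ Finset.range k, F (g r) ≤ I.f i₀ := by
      rw [hsum F]
      exact (Finset.sum_le_sum_of_subset_of_nonneg (Finset.subset_univ S)
        fun _ _ _ => hF0 _).trans (h.sum_le i₀ hpq)
    have h2 := sum_range_mul_div 100000 k hM fun r => F (g r)
    rw [← Finset.sum_range_add_sum_Ico _ (hil.trans hl.le)] at h2
    refine le_trans (add_le_add (Finset.sum_le_sum fun j hj => ?_)
      (Finset.sum_le_sum fun j hj => ?_)) (h2.le.trans ?_)
    · have hj : s.α (g (j / 100000)) ≤ s.α p :=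
        hgm (Nat.div_le_div_right (Finset.mem_range.1 hj).le)
      simp only [F]
      split_ifs with hlt
      · exact le_rfl
      -- Here `j` precedes `i` in the list but has the same α as `p`, so its summand is max (α p − d
      -- j) 0; since α q ≤ α j + d j + d q, this is still large enough.
      · have h3 := h.α_le hc i₀ (g (j / 100000)) q
        exact max_le_max (by linarith) le_rfl
    · have hj : s.α p ≤ s.α (g (j / 100000)) :=
        hgm (Nat.div_le_div_right (Finset.mem_Ico.1 hj).1)
      simp only [F]
      rw [if_neg hj.not_gt]
    · push_cast; linarith

/-- An optimal solution is split into stars, one for each open facility. A star without cities only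
has to pay its nonnegative opening cost. -/
theorem Solution.IsOutput.cost_le {I : Instance} {x : Solution I} (hx : x.IsOutput) :
    x.cost ≤ 1.61 * I.opt := by
  obtain ⟨k, s, hs, ho, hc⟩ := hx
  obtain ⟨y, hy, hcost⟩ := I.isLeast_opt.1
  rw [Solution.cost_eq_sum_α hs.inv ho hc, ← hcost, Solution.cost]
  have h1 : ∀ F : Fin I.nc → ℝ,
      ∑ j, F j = ∑ i ∈ y.opened, ∑ j with y.assign j = i, F j := fun F =>
    (Finset.sum_fiberwise_of_maps_to (fun j _ => hy j) F).symm
  rw [h1 s.α, h1 fun j => I.c (y.assign j) j, ← Finset.sum_add_distrib, Finset.mul_sum]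
  refine Finset.sum_le_sum fun i _ => ?_
  have h2 : ∑ j with y.assign j = i, I.c (y.assign j) j = ∑ j with y.assign j = i, I.c i j :=
    Finset.sum_congr rfl fun j hj => by rw [(Finset.mem_filter.1 hj).2]
  rw [h2]
  rcases (Finset.univ.filter fun j => y.assign j = i).eq_empty_or_nonempty with he | hne
  · rw [he]; simp only [Finset.sum_empty, add_zero]
    exact mul_nonneg (by norm_num) (I.f_nonneg i)
  · exact hs.history.sum_α_le (fun j => by simp [hc j]) i _ hne

end FacilityLocation

namespace FacilityLocation

/-! ### A family of bad instances -/

/-- Data of a bad instance: the cities `j` are at distance `d j` from a facility of cost `f`, and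
each has a private facility, of cost `A j - d j` at distance `d j`, that will open at time `A j`. -/
structure BadData (k : ℕ) where
  A : Fin k → ℝ
  d : Fin k → ℝ
  f : ℝ
  d_pos : ∀ j, 0 < d j
  d_lt : ∀ j, d j < A j
  A_lt : ∀ p j, A j < 2 * d p + d j
  mono : Monotone A
  f_nonneg : 0 ≤ f
  sum_lt : ∀ j, ∑ j' ∈ Finset.Ici j, max (A j - d j') 0 < f

namespace BadData

variable {k : ℕ} (b : BadData k)

/-- Connection costs: facility `0` is the common one, facility `p + 1` is private to city `p`. -/
def cost (i : Fin (k + 1)) (j : Fin k) : ℝ :=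
  Fin.cases (motive := fun _ => ℝ) (b.d j)
    (fun p => if p = j then b.d j else 2 * b.d p + b.d j) i

@[simp] theorem cost_zero (j : Fin k) : b.cost 0 j = b.d j := rfl

theorem cost_succ (p j : Fin k) :
    b.cost p.succ j = if p = j then b.d j else 2 * b.d p + b.d j := rfl

@[simp] theorem cost_self (j : Fin k) : b.cost j.succ j = b.d j := by simp [cost_succ]

theorem cost_of_ne {p j : Fin k} (h : p ≠ j) : b.cost p.succ j = 2 * b.d p + b.d j := by
  simp [cost_succ, h]

theorem le_cost (i : Fin (k + 1)) (j : Fin k) : b.d j ≤ b.cost i j := by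
  induction i using Fin.cases with
  | zero => exact le_rfl
  | succ p =>
    rw [cost_succ]
    split_ifs
    · exact le_rfl
    · linarith [b.d_pos p]

/-- The bad instance. -/
abbrev inst : Instance where
  nf := k + 1
  nc := k
  nf_pos := Nat.succ_pos k
  f := Fin.cases b.f fun p => b.A p - b.d p
  c := b.cost
  f_nonneg := by
    intro i
    induction i using Fin.cases with
    | zero => exact b.f_nonneg
    | succ p => exact sub_nonneg.2 (b.d_lt p).le
  c_nonneg := fun i j => (b.d_pos j).le.trans (b.le_cost i j)
  triangle := by
    intro i i' j j'
    have h1 := b.le_cost i j'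
    have h2 := b.le_cost i' j'
    have h3 := b.le_cost i' j
    have h4 := b.d_pos j'
    induction i using Fin.cases with
    | zero => simp only [cost_zero] at *; linarith
    | succ p =>
      rcases eq_or_ne p j with rfl | hne
      · rw [cost_self]; linarith
      · rw [b.cost_of_ne hne]
        rcases eq_or_ne p j' with rfl | hne'
        · linarith
        · rw [b.cost_of_ne hne']; linarith

/-- The invariant of the executions on the bad instance. -/
structure Inv (s : State b.inst) : Prop where
  zero_notMem : (0 : Fin (k + 1)) ∉ s.opened
  conn_eq : ∀ (j : Fin k) (i : Fin (k + 1)), s.conn j = some i → i = j.succ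
  succ_notMem : ∀ j : Fin k, s.conn j = none → (j.succ : Fin (k + 1)) ∉ s.opened
  time_le : ∀ j : Fin k, s.conn j = none → s.time ≤ b.A j

theorem Inv.init : b.Inv (State.init b.inst) where
  zero_notMem := Finset.notMem_empty _
  conn_eq := by simp [State.init]
  succ_notMem := fun j _ => Finset.notMem_empty _
  time_le := fun j _ => ((b.d_pos j).trans (b.d_lt j)).le

variable {b}

/-- The facility of another city is farther than A j ≥ t from an unconnected city `j`, and farther
than the own facility of a connected one. -/
theorem Inv.offer_eq_zero {s : State b.inst} (h : b.Inv s) (hi : s.Inv) {t : ℝ}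
    (ht : ∀ j : Fin k, s.conn j = none → t ≤ b.A j) {p j : Fin k} (hne : p ≠ j) :
    (s.raise t).offer (p.succ : Fin (k + 1)) j = 0 := by
  have hc : b.inst.c (p.succ : Fin (k + 1)) j = 2 * b.d p + b.d j := b.cost_of_ne hne
  by_cases hj : s.conn j = none
  · rw [hi.raise_offer_of_none hj, hc]
    have h1 := ht j hj
    have h2 := b.A_lt p j
    exact max_eq_right (by linarith)
  · obtain ⟨i, hi'⟩ := Option.ne_none_iff_exists'.1 hj
    rw [State.raise_offer_of_some hi', hc]
    obtain rfl := h.conn_eq j i hi'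
    have h3 : b.inst.c (j.succ : Fin (k + 1)) j = b.d j := b.cost_self j
    rw [h3]
    exact max_eq_right (by linarith [b.d_pos p])

theorem Inv.sum_offer_succ {s : State b.inst} (h : b.Inv s) (hi : s.Inv) {t : ℝ}
    (ht : ∀ j : Fin k, s.conn j = none → t ≤ b.A j) (p : Fin k) :
    ∑ j, (s.raise t).offer (p.succ : Fin (k + 1)) j =
      (s.raise t).offer (p.succ : Fin (k + 1)) (p : Fin k) :=
  Finset.sum_eq_single (M := ℝ) (ι := Fin k) p
    (fun _ _ hj => h.offer_eq_zero hi ht (Ne.symm hj)) (fun hp => absurd (Finset.mem_univ _) hp)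

theorem Inv.offer_self {s : State b.inst} (hi : s.Inv) (t : ℝ) {p : Fin k}
    (hp : s.conn p = none) :
    (s.raise t).offer (p.succ : Fin (k + 1)) (p : Fin k) = max (t - b.d p) 0 := by
  rw [hi.raise_offer_of_none hp]
  have : b.inst.c (p.succ : Fin (k + 1)) p = b.d p := b.cost_self p
  rw [this]

/-- Let `m` be the first unconnected city. At time A m it alone offers to its private facility, and
it offers exactly the opening cost, so the next event comes no later. -/
theorem Inv.next_le {s : State b.inst} (h : b.Inv s) (hi : s.Inv) {t : ℝ}
    (ht : s.NextEventTime t) :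
    ∃ m : Fin k, s.conn m = none ∧ (∀ j : Fin k, s.conn j = none → m ≤ j) ∧ t ≤ b.A m := by
  obtain ⟨j₀, hj₀⟩ := ht.1
  obtain ⟨m, hm, hmin⟩ := Finset.exists_min_image
    (Finset.univ.filter fun j : Fin k => s.conn j = none) id ⟨j₀, by simpa using hj₀⟩
  have hm' : s.conn m = none := by simpa using hm
  have hmin' : ∀ j : Fin k, s.conn j = none → m ≤ j := fun j hj => hmin j (by simpa using hj)
  refine ⟨m, hm', hmin', ?_⟩
  by_contra! hlt
  refine ht.2.2.2 _ (h.time_le m hm') hlt (Or.inl ⟨m.succ, h.succ_notMem m hm', ?_⟩)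
  rw [h.sum_offer_succ hi fun j hj => b.mono (hmin' j hj), Inv.offer_self hi _ hm']
  exact max_eq_left (sub_nonneg.2 (b.d_lt m).le)

theorem Inv.step {s s' : State b.inst} (h : b.Inv s) (hi : s.Inv)
    (hs : State.Step s s') : b.Inv s' := by
  have main : ∀ t, s.NextEventTime t → b.Inv (s.raise t) ∧
      ∃ m : Fin k, (∀ j : Fin k, s.conn j = none → m ≤ j) ∧ t ≤ b.A m := by
    intro t ht
    obtain ⟨m, -, hmin, hle⟩ := h.next_le hi ht
    exact ⟨⟨h.zero_notMem, h.conn_eq, h.succ_notMem,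
      fun j hj => hle.trans (b.mono (hmin j hj))⟩, m, hmin, hle⟩
  cases hs with
  | @openFacility t i ht ho =>
    obtain ⟨hr, m, hmin, hle⟩ := main t ht
    have htA : ∀ j : Fin k, s.conn j = none → t ≤ b.A j := fun j hj =>
      hle.trans (b.mono (hmin j hj))
    change Fin (k + 1) at i
    induction i using Fin.cases with
    | zero =>
      exfalso
      -- The centre cannot open: the cities before `m` are connected at the same distance and offer
      -- nothing, and those from `m` on offer at most max (A m − d j) 0.
      refine (b.sum_lt m).not_ge (ho.2.symm.le.trans ?_)
      rw [← Finset.sum_filter_add_sum_filter_not (Finset.univ : Finset (Fin k))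
        (fun j : Fin k => m ≤ j)]
      have h2 : ∑ j : Fin k with ¬ m ≤ j, (s.raise t).offer (0 : Fin (k + 1)) j = 0 := by
        refine Finset.sum_eq_zero fun j hj => ?_
        have hjn : s.conn j ≠ none := fun h0 => (Finset.mem_filter.1 hj).2 (hmin j h0)
        obtain ⟨i', hi'⟩ := Option.ne_none_iff_exists'.1 hjn
        rw [State.raise_offer_of_some hi']
        obtain rfl := h.conn_eq j i' hi'
        have h3 : b.inst.c (j.succ : Fin (k + 1)) j = b.d j := b.cost_self j
        have h4 : b.inst.c (0 : Fin (k + 1)) j = b.d j := rfl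
        rw [h3, h4]; simp
      have h3 : (Finset.univ.filter fun j : Fin k => m ≤ j) = Finset.Ici m := by ext; simp
      rw [h2, add_zero, h3]
      refine Finset.sum_le_sum fun j _ => ?_
      have h4 : b.inst.c (0 : Fin (k + 1)) j = b.d j := rfl
      by_cases hjn : s.conn j = none
      · rw [hi.raise_offer_of_none hjn, h4]
        exact max_le_max (by linarith) le_rfl
      · obtain ⟨i', hi'⟩ := Option.ne_none_iff_exists'.1 hjn
        rw [State.raise_offer_of_some hi']
        obtain rfl := h.conn_eq j i' hi'
        have h3 : b.inst.c (j.succ : Fin (k + 1)) j = b.d j := b.cost_self j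
        rw [h3, h4]; simp
    | succ p =>
      have hoff := ho.2
      rw [h.sum_offer_succ hi htA p] at hoff
      have hf : b.inst.f (p.succ : Fin (k + 1)) = b.A p - b.d p := rfl
      have hp : (s.raise t).offer (p.succ : Fin (k + 1)) p ≠ 0 := by
        rw [hoff, hf]; exact (sub_pos.2 (b.d_lt p)).ne'
      have hne : ∀ {j : Fin k}, j ≠ p →
          ((s.raise t).openFacility (p.succ : Fin (k + 1))).conn j = s.conn j := by
        intro j hj
        rw [State.openFacility_conn_of_offer_eq (h.offer_eq_zero hi htA hj.symm)]
        rfl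
      have heq := State.openFacility_conn_of_offer_ne hp
      refine ⟨?_, fun j i hj => ?_, fun j hj hm => ?_, fun j hj => ?_⟩
      · intro hm
        rcases Finset.mem_insert.1 hm with h0 | h0
        · exact Fin.succ_ne_zero p h0.symm
        · exact h.zero_notMem h0
      · rcases eq_or_ne j p with rfl | hjp
        · exact Option.some.inj (hj.symm.trans heq)
        · exact h.conn_eq j i ((hne hjp).symm.trans hj)
      · rcases eq_or_ne j p with rfl | hjp
        · exact absurd (heq.symm.trans hj) (by simp)
        · rcases Finset.mem_insert.1 hm with h0 | h0
          · exact hjp (Fin.succ_injective _ h0)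
          · exact h.succ_notMem j ((hne hjp).symm.trans hj) h0
      · rcases eq_or_ne j p with rfl | hjp
        · exact absurd (heq.symm.trans hj) (by simp)
        · exact htA j ((hne hjp).symm.trans hj)
  | @connect t i j ht ho =>
    -- No city is ever connected by event (b): the centre and the city's own facility are unopened,
    -- and every other facility is farther than A j.
    exfalso
    obtain ⟨hr, m, hmin, hle⟩ := main t ht
    obtain ⟨h1, h2, h3⟩ := ho
    have h2 : s.conn j = none := h2
    have h1 : i ∈ s.opened := h1
    rw [hi.raise_α h2] at h3
    have h4 : t ≤ b.A j := hle.trans (b.mono (hmin j h2))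
    change Fin (k + 1) at i
    change Fin k at j
    induction i using Fin.cases with
    | zero => exact h.zero_notMem h1
    | succ p =>
      rcases eq_or_ne p j with rfl | hne
      · exact h.succ_notMem p h2 h1
      · have h5 : b.inst.c (p.succ : Fin (k + 1)) j = 2 * b.d p + b.d j := b.cost_of_ne hne
        have h6 := b.A_lt p j
        linarith

variable (b)

theorem inv_of_reached {n : ℕ} {s : State b.inst} (h : State.Reached n s) : b.Inv s := by
  induction h with
  | init => exact Inv.init b
  | step hr hs ih => exact ih.step hr.inv hs

theorem output_cost {x : Solution b.inst} (hx : x.IsOutput) : x.cost = ∑ j, b.A j := by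
  obtain ⟨n, s, hs, ho, hc⟩ := hx
  have hi := b.inv_of_reached hs
  have hassign : ∀ j : Fin k, x.assign j = j.succ := fun j => hi.conn_eq j _ (hc j)
  have hopen : x.opened = Finset.univ.map (Fin.succEmb k) := by
    rw [← ho]
    ext i
    change Fin (k + 1) at i
    induction i using Fin.cases with
    | zero => simpa [Fin.succ_ne_zero] using hi.zero_notMem
    | succ p =>
      refine iff_of_true ?_ (Finset.mem_map.2 ⟨p, Finset.mem_univ _, rfl⟩)
      exact hs.inv.mem_opened (j := p) ((hc p).trans (congrArg some (hassign p)))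
  have h1 : ∑ i ∈ x.opened, b.inst.f i = ∑ j, (b.A j - b.d j) := by
    rw [hopen]; exact Finset.sum_map _ _ _
  have h2 : ∑ j, b.inst.c (x.assign j) j = ∑ j, b.d j :=
    Finset.sum_congr (s₁ := (Finset.univ : Finset (Fin k))) rfl fun j _ => by
      rw [hassign j]; exact b.cost_self j
  rw [Solution.cost, h1, h2, ← Finset.sum_add_distrib]
  simp

theorem opt_le : b.inst.opt ≤ b.f + ∑ j, b.d j := by
  refine b.inst.isLeast_opt.2 ⟨⟨{(0 : Fin (k + 1))}, fun _ => (0 : Fin (k + 1))⟩,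
    fun j => Finset.mem_singleton_self _, ?_⟩
  change ∑ i ∈ {(0 : Fin (k + 1))}, b.inst.f i + ∑ j : Fin k, b.d j = _
  rw [Finset.sum_singleton]
  rfl

end BadData

/-! ### Numerical data -/

/-- `force n g = g n`, with the number evaluated first. -/
def force {β : Type} (n : ℕ) (g : ℕ → β) : β := Nat.rec (g 0) (fun m _ => g (Nat.succ m)) n

theorem force_eq {β : Type} (n : ℕ) (g : ℕ → β) : force n g = g n := by
  cases n <;> rfl

/-- Total offer at time `A` of cities at the given increasing distances, plus `acc`. -/
noncomputable def offers (A : ℕ) (L : List (ℕ × ℕ)) : ℕ → ℕ :=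
  List.rec (fun acc => acc)
    (fun p _ ih acc => cond (Nat.ble A p.2) acc (force (Nat.add acc (Nat.sub A p.2)) ih)) L

/-- A candidate for the largest `A` for which the offers stay below `f`, for cities at increasing
distances, the first `n` of which add up to `S`, and another city at distance `max h (A - N)`,
where `F = f - 1 + h` and `H = N + h`. -/
noncomputable def candidate (F H : ℕ) (L : List (ℕ × ℕ)) : ℕ → ℕ → ℕ :=
  List.rec (fun n S => Nat.max ((F + S) / (n + 1)) ((F + S - H) / n))
    (fun p _ ih n S => cond (Nat.ble (Nat.mul (Nat.succ n) p.2) (Nat.add F S))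
      (force (Nat.succ n) fun n' => force (Nat.add S p.2) (ih n'))
      (Nat.max ((F + S) / (n + 1)) ((F + S - H) / n))) L

/-- Extend a list of pairs `(A, d)`, the first of which is `(B, E)`, at the front by at most `k`
further cities. -/
noncomputable def profile (f h N : ℕ) : ℕ → ℕ → ℕ → List (ℕ × ℕ) → List (ℕ × ℕ)
  | 0, _, _, L => L
  | k + 1, B, E, L =>
    force (f - 1 + h) fun F => force (N + h) fun H => force (Nat.min B (candidate F H L 0 0)) fun A =>
      force (Nat.max h (A - N)) fun d =>
        cond (Nat.ble d E && (Nat.ble (d + 1) A && (Nat.ble A (d + N) &&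
            Nat.ble (offers A L (A - d) + 1) f)))
          (profile f h N k A d ((A, d) :: L)) L

/-- Whether the cities of a list have costs `A` adding up to at least `1.598` times `f` plus their
distances, given the sums over the cities already treated. -/
def ratioLarge : List (ℕ × ℕ) → ℕ → ℕ → Bool
  | [], a, d => Nat.ble (1598 * d) (1000 * a)
  | p :: L, a, d => force (a + p.1) fun a' => force (d + p.2) fun d' => ratioLarge L a' d'

end FacilityLocation

/-! ### Verification of the numerical profile -/

namespace FacilityLocation

/-- The conditions of `BadData` on a list of pairs `(A, d)`. -/
structure IsProfile (f h N : ℕ) (L : List (ℕ × ℕ)) : Prop where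
  sorted : L.Pairwise fun p q => p.1 ≤ q.1 ∧ p.2 ≤ q.2
  bounds : ∀ p ∈ L, h ≤ p.2 ∧ p.2 < p.1 ∧ p.1 ≤ p.2 + N
  offers_lt : ∀ p L', p :: L' <:+ L → ((p :: L').map fun q => p.1 - q.2).sum < f

/-- Stopping at the first distance that is at least `A` loses nothing, because the distances
increase. -/
theorem offers_eq (A : ℕ) {L : List (ℕ × ℕ)} (hL : L.Pairwise fun p q => p.2 ≤ q.2) (acc : ℕ) :
    offers A L acc = acc + (L.map fun p => A - p.2).sum := by
  induction L generalizing acc with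
  | nil => rfl
  | cons p L ih =>
    rw [List.pairwise_cons] at hL
    change cond (Nat.ble A p.2) acc (force (Nat.add acc (Nat.sub A p.2)) (offers A L)) = _
    rw [force_eq, ih hL.2]
    cases hb : Nat.ble A p.2 with
    | true =>
      have hA : A ≤ p.2 := Nat.le_of_ble_eq_true hb
      have h0 : (L.map fun q => A - q.2).sum = 0 := by
        rw [List.sum_eq_zero_iff]
        simp only [List.mem_map]
        rintro _ ⟨q, hq, rfl⟩
        exact Nat.sub_eq_zero_of_le (hA.trans (hL.1 q hq))
      simp [h0, hA]
    | false =>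
      simp [add_assoc]

/-- Nothing about `candidate` is needed: a city is added only after a test of all the required
inequalities, apart from A ≤ B and h ≤ d, which hold by construction. -/
theorem IsProfile.profile {f h N : ℕ} (k : ℕ) {B E : ℕ} {L : List (ℕ × ℕ)}
    (hL : IsProfile f h N L) (hB : ∀ p ∈ L, B ≤ p.1 ∧ E ≤ p.2) :
    IsProfile f h N (profile f h N k B E L) := by
  induction k generalizing B E L with
  | zero => exact hL
  | succ k ih =>
    rw [FacilityLocation.profile]
    simp only [force_eq]
    set A := Nat.min B (candidate (f - 1 + h) (N + h) L 0 0) with hA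
    set d := Nat.max h (A - N) with hd
    have hAB : A ≤ B := Nat.min_le_left _ _
    have hhd : h ≤ d := Nat.le_max_left _ _
    cases hc : (Nat.ble d E && (Nat.ble (d + 1) A && (Nat.ble A (d + N) &&
            Nat.ble (offers A L (A - d) + 1) f))) with
    | false => exact hL
    | true =>
      simp only [Bool.and_eq_true, Nat.ble_eq] at hc
      obtain ⟨h1, h2, h3, h4⟩ := hc
      rw [offers_eq A (hL.sorted.imp fun h => h.2)] at h4
      refine ih ⟨?_, ?_, ?_⟩ ?_
      · exact List.pairwise_cons.2 ⟨fun p hp => ⟨hAB.trans (hB p hp).1, h1.trans (hB p hp).2⟩,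
          hL.sorted⟩
      · rintro p hp
        rcases List.mem_cons.1 hp with rfl | hp
        · exact ⟨hhd, h2, h3⟩
        · exact hL.bounds p hp
      · intro p L' hp
        rcases List.suffix_cons_iff.1 hp with heq | hp
        · obtain ⟨rfl, rfl⟩ := List.cons.inj heq
          simpa using h4
        · exact hL.offers_lt p L' hp
      · intro p hp
        rcases List.mem_cons.1 hp with rfl | hp
        · exact ⟨le_rfl, le_rfl⟩
        · exact ⟨hAB.trans (hB p hp).1, h1.trans (hB p hp).2⟩

theorem ratioLarge_iff (L : List (ℕ × ℕ)) (a d : ℕ) :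
    ratioLarge L a d = true ↔
      1598 * (d + (L.map Prod.snd).sum) ≤ 1000 * (a + (L.map Prod.fst).sum) := by
  induction L generalizing a d with
  | nil => simp [ratioLarge]
  | cons p L ih => simp [ratioLarge, force_eq, ih, add_assoc]

theorem sum_get_of_le (L : List (ℕ × ℕ)) (g : ℕ × ℕ → ℕ) (m : ℕ) :
    ∑ x : Fin L.length, (if m ≤ x then g (L.get x) else 0) = ((L.drop m).map g).sum := by
  induction L generalizing m with
  | nil => simp
  | cons p L ih =>
    cases m with
    | zero => have := ih 0; simp_all [Fin.sum_univ_succ]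
    | succ m => have := ih m; simp_all [Fin.sum_univ_succ]

/-- The bad instance given by a list of pairs `(A, d)`. -/
noncomputable def IsProfile.badData {f h N : ℕ} {L : List (ℕ × ℕ)} (hL : IsProfile f h N L)
    (hh : 0 < h) (hN : N < 2 * h) : BadData L.length where
  A j := (L.get j).1
  d j := (L.get j).2
  f := f
  d_pos j := by
    have := hL.bounds _ (L.get_mem j)
    exact_mod_cast hh.trans_le this.1
  d_lt j := by
    have := hL.bounds _ (L.get_mem j)
    exact_mod_cast this.2.1
  A_lt p j := by
    have h1 := hL.bounds _ (L.get_mem p)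
    have h2 := hL.bounds _ (L.get_mem j)
    -- A j ≤ d j + N < d j + 2 h ≤ d j + 2 d p.
    have : (L.get j).1 < 2 * (L.get p).2 + (L.get j).2 := by omega
    exact_mod_cast this
  mono := by
    intro i j hij
    rcases hij.eq_or_lt with rfl | hlt
    · exact le_rfl
    · change ((L.get i).1 : ℝ) ≤ ((L.get j).1 : ℝ)
      exact_mod_cast (List.pairwise_iff_get.1 hL.sorted i j hlt).1
  f_nonneg := Nat.cast_nonneg f
  sum_lt j := by
    have h1 : L.drop j = L.get j :: L.drop (j + 1) := List.drop_eq_getElem_cons j.2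
    have h2 := hL.offers_lt (L.get j) (L.drop (j + 1)) (h1 ▸ List.drop_suffix _ _)
    rw [← h1, ← sum_get_of_le] at h2
    have h3 : ∑ j' ∈ Finset.Ici j, max (((L.get j).1 : ℝ) - ((L.get j').2 : ℝ)) 0
        = ((∑ x : Fin L.length, (if (j : ℕ) ≤ x then (L.get j).1 - (L.get x).2 else 0) : ℕ) : ℝ) := by
      have h4 : Finset.Ici j = Finset.univ.filter fun x : Fin L.length => (j : ℕ) ≤ x := by
        ext x; simp
      rw [h4, Finset.sum_filter, Nat.cast_sum]
      refine Finset.sum_congr rfl fun x _ => ?_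
      split_ifs
      · rcases le_total (L.get j).1 (L.get x).2 with hle | hle
        · rw [Nat.sub_eq_zero_of_le hle, Nat.cast_zero]
          exact max_eq_right (sub_nonpos.2 (by exact_mod_cast hle))
        · rw [Nat.cast_sub hle]
          exact max_eq_left (sub_nonneg.2 (by exact_mod_cast hle))
      · simp
    rw [h3]
    exact_mod_cast h2

/-- The constants are f = 57000000, N = 10⁶ and h = 500001, the least h with N < 2 h; at most 300
cities are generated, starting with A = 2320000 and d = A − N. The distance sum starts at f, so that
f is included in the denominator. -/
theorem ratioLarge_profile :
    ratioLarge (profile 57000000 500001 1000000 300 2320000 1320000 []) 0 57000000 = true := by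
  decide +kernel

/-- An instance on which the algorithm loses a factor `1.598`. -/
theorem exists_bad_instance :
    ∃ I : Instance, ∀ x : Solution I, x.IsOutput → 1.598 * I.opt ≤ x.cost ∧ 0 < x.cost := by
  have hnil : IsProfile 57000000 500001 1000000 [] :=
    ⟨List.Pairwise.nil, by simp, fun p L' h => by simpa using h.length_le⟩
  have hL := hnil.profile 300 (B := 2320000) (E := 1320000) (by simp)
  have hr := (ratioLarge_iff _ _ _).1 ratioLarge_profile
  generalize profile 57000000 500001 1000000 300 2320000 1320000 [] = L at hL hr
  set b := hL.badData (by norm_num) (by norm_num) with hb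
  refine ⟨b.inst, fun x hx => ?_⟩
  have hc := b.output_cost hx
  have ho := b.opt_le
  have hsum : ∀ g : ℕ × ℕ → ℕ, ∑ j : Fin L.length, (g (L.get j) : ℝ) = (L.map g).sum := by
    intro g
    have := sum_get_of_le L g 0
    simp only [zero_le, if_true, List.drop_zero] at this
    exact_mod_cast this
  have hA : ∑ j, b.A j = (L.map Prod.fst).sum := hsum Prod.fst
  have hd : ∑ j, b.d j = (L.map Prod.snd).sum := hsum Prod.snd
  have hf : b.f = 57000000 := by simp [hb, IsProfile.badData]
  rw [hA] at hc
  rw [hd, hf] at ho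
  rw [hc]
  have hr' : (1598 : ℝ) * (57000000 + (L.map Prod.snd).sum) ≤ 1000 * (L.map Prod.fst).sum := by
    have := (Nat.cast_le (α := ℝ)).2 hr
    push_cast at this ⊢
    linarith
  have hpos : (0 : ℝ) ≤ (L.map Prod.snd).sum := Nat.cast_nonneg _
  constructor <;> linarith

/-- The approximation ratio exists and lies between `1.598` and `1.61`. -/
theorem TieBreaking.exists_ratio (A : TieBreaking) :
    ∃ ρ : ℝ, IsLeast {γ : ℝ | IsApproxFactor A.out γ} ρ ∧ 1.598 ≤ ρ ∧ ρ ≤ 1.61 := by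
  set S := {γ : ℝ | IsApproxFactor A.out γ} with hS
  have hup : (1.61 : ℝ) ∈ S := fun I => (A.isOutput I).cost_le
  have hlow : ∀ γ ∈ S, 1.598 ≤ γ := by
    intro γ hγ
    obtain ⟨I, hI⟩ := exists_bad_instance
    obtain ⟨h1, h2⟩ := hI _ (A.isOutput I)
    have h3 := hγ I
    have h4 := hup I
    -- The output has positive cost, at most 1.61 times the optimum.
    have h5 : 0 < I.opt := by
      by_contra! h
      linarith
    by_contra! h
    nlinarith
  have hcl : IsClosed S := by
    have : S = ⋂ I : Instance, {γ : ℝ | (A.out I).cost ≤ γ * I.opt} := by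
      ext γ; simp [hS, IsApproxFactor]
    rw [this]
    exact isClosed_iInter fun I => isClosed_le continuous_const (by fun_prop)
  have hbdd : BddBelow S := ⟨1.598, hlow⟩
  have hmem := hcl.csInf_mem ⟨_, hup⟩ hbdd
  exact ⟨sInf S, ⟨hmem, fun γ hγ => csInf_le hbdd hγ⟩, hlow _ hmem, csInf_le hbdd hup⟩

end FacilityLocation

/-! ### Counting-loop programs: semantics and running time -/

namespace RealRAM

namespace Mem

@[simp] theorem setNat_reals (m : Mem) (a i j x : ℕ) : (m.setNat a i j x).reals = m.reals := rfl

@[simp] theorem setReal_nats (m : Mem) (a i j : ℕ) (x : ℝ) : (m.setReal a i j x).nats = m.nats :=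
  rfl

theorem setNat_nats (m : Mem) (a i j x a' i' j' : ℕ) : (m.setNat a i j x).nats a' i' j' =
    if a' = a ∧ i' = i ∧ j' = j then x else m.nats a' i' j' := rfl

theorem setReal_reals (m : Mem) (a i j : ℕ) (x : ℝ) (a' i' j' : ℕ) :
    (m.setReal a i j x).reals a' i' j' =
      if a' = a ∧ i' = i ∧ j' = j then x else m.reals a' i' j' := rfl

theorem setNat_nats_of_ne (m : Mem) {a a' : ℕ} (h : a' ≠ a) (i j x : ℕ) :
    (m.setNat a i j x).nats a' = m.nats a' := by
  funext i' j'; simp [setNat_nats, h]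

theorem setReal_reals_of_ne (m : Mem) {a a' : ℕ} (h : a' ≠ a) (i j : ℕ) (x : ℝ) :
    (m.setReal a i j x).reals a' = m.reals a' := by
  funext i' j'; simp [setReal_reals, h]

end Mem

/-- Cell `(0, 0)` of an array of natural numbers, used as a variable. -/
abbrev nvar (a : ℕ) : NExpr := .get a (.const 0) (.const 0)

/-- Cell `(0, 0)` of an array of real numbers, used as a variable. -/
abbrev rvar (a : ℕ) : RExpr := .get a (.const 0) (.const 0)

/-- The expression only reads array `0`. -/
def NExpr.sizeOnly : NExpr → Bool
  | const _ => true
  | get a i j => a == 0 && i.sizeOnly && j.sizeOnly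
  | add e₁ e₂ => e₁.sizeOnly && e₂.sizeOnly
  | sub e₁ e₂ => e₁.sizeOnly && e₂.sizeOnly

/-- A bound for the value of an expression whose cells contain numbers up to `n`. -/
def NExpr.bound (n : ℕ) : NExpr → ℕ
  | const c => c
  | get _ _ _ => n
  | add e₁ e₂ => e₁.bound n + e₂.bound n
  | sub e₁ _ => e₁.bound n

theorem NExpr.eval_congr {m m' : Mem} (h : m'.nats 0 = m.nats 0) {e : NExpr}
    (he : e.sizeOnly = true) : e.eval m' = e.eval m := by
  induction e with
  | const _ => rfl
  | get a i j hi hj =>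
    simp only [sizeOnly, Bool.and_eq_true, beq_iff_eq] at he
    obtain ⟨⟨rfl, h1⟩, h2⟩ := he
    simp only [eval, hi h1, hj h2, h]
  | add _ _ h1 h2 =>
    simp only [sizeOnly, Bool.and_eq_true] at he
    simp only [eval, h1 he.1, h2 he.2]
  | sub _ _ h1 h2 =>
    simp only [sizeOnly, Bool.and_eq_true] at he
    simp only [eval, h1 he.1, h2 he.2]

theorem NExpr.eval_le_bound {m : Mem} {n : ℕ} (h : ∀ i j, m.nats 0 i j ≤ n) {e : NExpr}
    (he : e.sizeOnly = true) : e.eval m ≤ e.bound n := by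
  induction e with
  | const _ => exact le_rfl
  | get a i j _ _ =>
    simp only [sizeOnly, Bool.and_eq_true, beq_iff_eq] at he
    obtain ⟨⟨rfl, -⟩, -⟩ := he
    exact h _ _
  | add _ _ h1 h2 =>
    simp only [sizeOnly, Bool.and_eq_true] at he
    exact Nat.add_le_add (h1 he.1) (h2 he.2)
  | sub _ _ h1 _ =>
    simp only [sizeOnly, Bool.and_eq_true] at he
    exact (Nat.sub_le _ _).trans (h1 he.1)

/-- Programs with counting loops only. -/
inductive LoopProg
  | skip
  | nset (a : ℕ) (i j : NExpr) (e : NExpr)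
  | rset (a : ℕ) (i j : NExpr) (e : RExpr)
  | seq (p₁ p₂ : LoopProg)
  | ite (b : Test) (p₁ p₂ : LoopProg)
  | loop (a : ℕ) (e : NExpr) (p : LoopProg)

namespace LoopProg

/-- Translation to programs of the machine: `loop a e p` executes `p` for the values
`0, …, e - 1` of the variable `a`. -/
def compile : LoopProg → Prog
  | skip => .skip
  | nset a i j e => .nset a i j e
  | rset a i j e => .rset a i j e
  | seq p₁ p₂ => .seq p₁.compile p₂.compile
  | ite b p₁ p₂ => .ite b p₁.compile p₂.compile
  | loop a e p => .seq (.nset a (.const 0) (.const 0) (.const 0))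
      (.while (.nle (.add (nvar a) (.const 1)) e)
        (.seq p.compile (.nset a (.const 0) (.const 0) (.add (nvar a) (.const 1)))))

open Classical in
/-- The memory after the execution of a program. -/
noncomputable def run : LoopProg → Mem → Mem
  | skip, m => m
  | nset a i j e, m => m.setNat a (i.eval m) (j.eval m) (e.eval m)
  | rset a i j e, m => m.setReal a (i.eval m) (j.eval m) (e.eval m)
  | seq p₁ p₂, m => p₂.run (p₁.run m)
  | ite b p₁ p₂, m => if b.eval m then p₁.run m else p₂.run m
  | loop a e p, m =>
    Nat.rec (m.setNat a 0 0 0) (fun x m' => (p.run m').setNat a 0 0 (x + 1)) (e.eval m)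

theorem run_ite_pos {b : Test} {m : Mem} (h : b.eval m) (p₁ p₂ : LoopProg) :
    (ite b p₁ p₂).run m = p₁.run m := by rw [run, if_pos h]

theorem run_ite_neg {b : Test} {m : Mem} (h : ¬ b.eval m) (p₁ p₂ : LoopProg) :
    (ite b p₁ p₂).run m = p₂.run m := by rw [run, if_neg h]

/-- A bound for the running time when array `0` contains numbers up to `n`. -/
def time (n : ℕ) : LoopProg → ℕ
  | skip => 1
  | nset _ i j e => i.time + j.time + e.time + 1
  | rset _ i j e => i.time + j.time + e.time + 1
  | seq p₁ p₂ => p₁.time n + p₂.time n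
  | ite b p₁ p₂ => b.time + (p₁.time n + p₂.time n)
  | loop _ e p => 4 + (e.bound n * (e.time + 6 + (p.time n + 8)) + (e.time + 6))

/-- The array `a` of natural numbers is not written. -/
def keepsNat (a : ℕ) : LoopProg → Bool
  | skip => true
  | nset a' _ _ _ => a' != a
  | rset _ _ _ _ => true
  | seq p₁ p₂ => p₁.keepsNat a && p₂.keepsNat a
  | ite _ p₁ p₂ => p₁.keepsNat a && p₂.keepsNat a
  | loop a' _ p => a' != a && p.keepsNat a

/-- The array `a` of real numbers is not written. -/
def keepsReal (a : ℕ) : LoopProg → Bool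
  | skip => true
  | nset _ _ _ _ => true
  | rset a' _ _ _ => a' != a
  | seq p₁ p₂ => p₁.keepsReal a && p₂.keepsReal a
  | ite _ p₁ p₂ => p₁.keepsReal a && p₂.keepsReal a
  | loop _ _ p => p.keepsReal a

/-- Loop bounds depend on array `0` only, which is not written, and loop bodies do not write the
loop variable. -/
def valid : LoopProg → Bool
  | skip => true
  | nset a _ _ _ => a != 0
  | rset _ _ _ _ => true
  | seq p₁ p₂ => p₁.valid && p₂.valid
  | ite _ p₁ p₂ => p₁.valid && p₂.valid
  | loop a e p => a != 0 && e.sizeOnly && p.keepsNat a && p.valid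

theorem keepsNat_zero_of_valid {p : LoopProg} (h : p.valid = true) : p.keepsNat 0 = true := by
  induction p with
  | skip => rfl
  | nset => exact h
  | rset => rfl
  | seq _ _ h1 h2 =>
    simp only [valid, keepsNat, Bool.and_eq_true] at h ⊢
    exact ⟨h1 h.1, h2 h.2⟩
  | ite _ _ _ h1 h2 =>
    simp only [valid, keepsNat, Bool.and_eq_true] at h ⊢
    exact ⟨h1 h.1, h2 h.2⟩
  | loop a e p hp =>
    simp only [valid, keepsNat, Bool.and_eq_true] at h ⊢
    exact ⟨h.1.1.1, hp h.2⟩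

theorem run_nats {p : LoopProg} {a : ℕ} (h : p.keepsNat a = true) (m : Mem) :
    (p.run m).nats a = m.nats a := by
  induction p generalizing m with
  | skip => rfl
  | nset a' i j e =>
    simp only [keepsNat, bne_iff_ne] at h
    exact m.setNat_nats_of_ne h.symm _ _ _
  | rset => rfl
  | seq _ _ h1 h2 =>
    simp only [keepsNat, Bool.and_eq_true] at h
    rw [run, h2 h.2, h1 h.1]
  | ite _ _ _ h1 h2 =>
    simp only [keepsNat, Bool.and_eq_true] at h
    rw [run]
    split_ifs
    · exact h1 h.1 m
    · exact h2 h.2 m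
  | loop a' e p hp =>
    simp only [keepsNat, Bool.and_eq_true, bne_iff_ne] at h
    rw [run]
    induction e.eval m with
    | zero => exact m.setNat_nats_of_ne h.1.symm _ _ _
    | succ x ih => exact (Mem.setNat_nats_of_ne _ h.1.symm _ _ _).trans ((hp h.2 _).trans ih)

theorem run_reals {p : LoopProg} {a : ℕ} (h : p.keepsReal a = true) (m : Mem) :
    (p.run m).reals a = m.reals a := by
  induction p generalizing m with
  | skip => rfl
  | nset => rfl
  | rset a' i j e =>
    simp only [keepsReal, bne_iff_ne] at h
    exact m.setReal_reals_of_ne h.symm _ _ _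
  | seq _ _ h1 h2 =>
    simp only [keepsReal, Bool.and_eq_true] at h
    rw [run, h2 h.2, h1 h.1]
  | ite _ _ _ h1 h2 =>
    simp only [keepsReal, Bool.and_eq_true] at h
    rw [run]
    split_ifs
    · exact h1 h.1 m
    · exact h2 h.2 m
  | loop a' e p hp =>
    simp only [keepsReal] at h
    rw [run]
    induction e.eval m with
    | zero => rfl
    | succ x ih => exact (hp h _).trans ih

/-- `m'` agrees with `m` on the arrays that `p` does not write. -/
def Frame (p : LoopProg) (m m' : Mem) : Prop :=
  (∀ a, p.keepsNat a = true → m'.nats a = m.nats a) ∧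
    ∀ a, p.keepsReal a = true → m'.reals a = m.reals a

theorem frame_run (p : LoopProg) (m : Mem) : p.Frame m (p.run m) :=
  ⟨fun _ h => run_nats h m, fun _ h => run_reals h m⟩

/-- Reasoning about loops with an invariant. -/
theorem run_loop_induction {a : ℕ} {e : NExpr} {p : LoopProg} {m : Mem}
    (Inv : ℕ → Mem → Prop) (h0 : Inv 0 (m.setNat a 0 0 0))
    (hs : ∀ x < e.eval m, ∀ m', (loop a e p).Frame m m' → m'.nats a 0 0 = x → Inv x m' →
      Inv (x + 1) ((p.run m').setNat a 0 0 (x + 1))) :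
    Inv (e.eval m) ((loop a e p).run m) := by
  rw [run]
  suffices ∀ x ≤ e.eval m, ∀ m', m' = (Nat.rec (m.setNat a 0 0 0)
      (fun x m' => (p.run m').setNat a 0 0 (x + 1)) x : Mem) →
      Inv x m' ∧ m'.nats a 0 0 = x ∧ (loop a e p).Frame m m' from
    (this _ le_rfl _ rfl).1
  intro x
  induction x with
  | zero =>
    rintro - m' rfl
    refine ⟨h0, by simp [Mem.setNat_nats], fun a' ha' => ?_, fun a' _ => rfl⟩
    simp only [keepsNat, Bool.and_eq_true, bne_iff_ne] at ha'
    exact m.setNat_nats_of_ne ha'.1.symm _ _ _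
  | succ x ih =>
    rintro hx m' rfl
    obtain ⟨h1, h2, h3⟩ := ih (by omega) _ rfl
    refine ⟨hs x (by omega) _ h3 h2 h1, by simp [Mem.setNat_nats], fun a' ha' => ?_,
      fun a' ha' => ?_⟩
    · have ha'' := ha'
      simp only [keepsNat, Bool.and_eq_true, bne_iff_ne] at ha'
      exact (Mem.setNat_nats_of_ne _ ha'.1.symm _ _ _).trans ((run_nats ha'.2 _).trans (h3.1 _ ha''))
    · exact (run_reals (p := p) ha' _).trans (h3.2 a' ha')

/-- A while loop unrolls at its first iteration, the recursor at its last; this moves one iteration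
to the front. -/
theorem rec_shift (g : ℕ → Mem → Mem) (x : ℕ) (m : Mem) (r : ℕ) :
    (Nat.rec m (fun y m' => g (x + y + 1) m') (r + 1) : Mem) =
      Nat.rec (g (x + 1) m) (fun y m' => g (x + 1 + y + 1) m') r := by
  induction r with
  | zero => rfl
  | succ r ih =>
    change g (x + (r + 1) + 1) (Nat.rec m (fun y m' => g (x + y + 1) m') (r + 1)) = _
    rw [ih, show x + (r + 1) + 1 = x + 1 + r + 1 by omega]

/-- Each test costs `e.time` + 6 and each increment 8. The body changes neither the counter nor
array 0, so the bound `e` keeps its value and exactly `r` iterations remain. -/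
theorem exec_while {a n : ℕ} {e : NExpr} {p : LoopProg} (ha : a ≠ 0) (he : e.sizeOnly = true)
    (hk : p.keepsNat a = true) (hk0 : p.keepsNat 0 = true)
    (hp : ∀ m : Mem, (∀ i j, m.nats 0 i j ≤ n) →
      ∃ T ≤ p.time n, Exec p.compile m T (p.run m))
    (r x : ℕ) (m : Mem) (hm : ∀ i j, m.nats 0 i j ≤ n) (hx : m.nats a 0 0 = x)
    (hr : e.eval m = x + r) :
    ∃ T ≤ r * (e.time + 6 + (p.time n + 8)) + (e.time + 6),
      Exec (.while (.nle (.add (nvar a) (.const 1)) e)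
        (.seq p.compile (.nset a (.const 0) (.const 0) (.add (nvar a) (.const 1))))) m T
        (Nat.rec m (fun y m' => (p.run m').setNat a 0 0 (x + y + 1)) r) := by
  induction r generalizing x m with
  | zero =>
    refine ⟨_, ?_, Exec.whileFalse ?_⟩
    · simp only [Test.time, NExpr.time]; omega
    · simp only [Test.eval, NExpr.eval, hx, hr]; omega
  | succ r ih =>
    obtain ⟨T₁, hT₁, h₁⟩ := hp m hm
    have hx₁ : (p.run m).nats a 0 0 = x := by rw [run_nats hk, hx]
    set m₂ := (p.run m).setNat a 0 0 (x + 1) with hm₂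
    have hz : m₂.nats 0 = m.nats 0 :=
      (Mem.setNat_nats_of_ne _ ha.symm _ _ _).trans (run_nats hk0 m)
    obtain ⟨T₂, hT₂, h₂⟩ := ih (x + 1) m₂ (by rw [hz]; exact hm)
      (by simp [hm₂, Mem.setNat_nats]) (by rw [NExpr.eval_congr hz he, hr]; omega)
    have h₃ : Exec (.nset a (.const 0) (.const 0) (.add (nvar a) (.const 1))) (p.run m) 8 m₂ := by
      have := Exec.nset (m := p.run m) (a := a) (i := .const 0) (j := .const 0)
        (e := .add (nvar a) (.const 1))
      simpa only [NExpr.time, NExpr.eval, hx₁] using this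
    have h₄ := rec_shift (fun y m' => (p.run m').setNat a 0 0 y) x m r
    refine ⟨_, ?_, h₄ ▸ Exec.whileTrue ?_ (Exec.seq h₁ h₃) h₂⟩
    · simp only [Test.time, NExpr.time]
      have h₅ := Nat.add_mul r 1 (e.time + 6 + (p.time n + 8))
      omega
    · simp only [Test.eval, NExpr.eval, hx, hr]; omega

/-- It separates the two tasks: correctness is proved for the function `run`, and the running time
is read off from the text of the program. -/
theorem exists_exec {p : LoopProg} (hv : p.valid = true) {n : ℕ} (m : Mem)
    (hm : ∀ i j, m.nats 0 i j ≤ n) : ∃ T ≤ p.time n, Exec p.compile m T (p.run m) := by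
  induction p generalizing m with
  | skip => exact ⟨1, le_rfl, Exec.skip⟩
  | nset => exact ⟨_, le_rfl, Exec.nset⟩
  | rset => exact ⟨_, le_rfl, Exec.rset⟩
  | seq p₁ p₂ h1 h2 =>
    simp only [valid, Bool.and_eq_true] at hv
    obtain ⟨T₁, hT₁, e₁⟩ := h1 hv.1 m hm
    obtain ⟨T₂, hT₂, e₂⟩ := h2 hv.2 (p₁.run m) (by rw [run_nats (keepsNat_zero_of_valid hv.1)]; exact hm)
    exact ⟨_, Nat.add_le_add hT₁ hT₂, Exec.seq e₁ e₂⟩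
  | ite b p₁ p₂ h1 h2 =>
    simp only [valid, Bool.and_eq_true] at hv
    by_cases hb : b.eval m
    · obtain ⟨T₁, hT₁, e₁⟩ := h1 hv.1 m hm
      refine ⟨_, ?_, by rw [run, if_pos hb]; exact Exec.iteTrue hb e₁⟩
      simp only [time]; omega
    · obtain ⟨T₂, hT₂, e₂⟩ := h2 hv.2 m hm
      refine ⟨_, ?_, by rw [run, if_neg hb]; exact Exec.iteFalse hb e₂⟩
      simp only [time]; omega
  | loop a e p hp =>
    simp only [valid, Bool.and_eq_true, bne_iff_ne] at hv
    obtain ⟨⟨⟨ha, he⟩, hk⟩, hv⟩ := hv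
    have hz : (m.setNat a 0 0 0).nats 0 = m.nats 0 := m.setNat_nats_of_ne ha.symm _ _ _
    obtain ⟨T, hT, h⟩ := exec_while (n := n) ha he hk (keepsNat_zero_of_valid hv) (hp hv) (e.eval m) 0
      (m.setNat a 0 0 0) (by rw [hz]; exact hm) (by simp [Mem.setNat_nats])
      (by rw [NExpr.eval_congr hz he, zero_add])
    refine ⟨4 + T, ?_, ?_⟩
    · have h2 := Nat.mul_le_mul_right (e.time + 6 + (p.time n + 8)) (NExpr.eval_le_bound hm he)
      simp only [time]; omega
    · rw [run]
      simp only [zero_add] at h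
      exact Exec.seq Exec.nset h

end LoopProg

end RealRAM

namespace FacilityLocation

/-! ### The time of the next event -/

section Threshold

variable {ι : Type*} (U : Finset ι) (c : ι → ℝ)

/-- Sum of the costs in `U` up to the cost of `j`. -/
noncomputable def costBelow (j : ι) : ℝ := ∑ j' ∈ U, if c j' ≤ c j then c j' else 0

/-- Number of costs in `U` up to the cost of `j`. -/
noncomputable def countBelow (j : ι) : ℝ := ∑ j' ∈ U, if c j' ≤ c j then 1 else 0

variable {U c}

theorem one_le_countBelow {j : ι} (hj : j ∈ U) : 1 ≤ countBelow U c j := by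
  refine le_trans (le_of_eq (if_pos le_rfl).symm) (Finset.single_le_sum
    (f := fun j' => if c j' ≤ c j then (1 : ℝ) else 0) (fun j' _ => ?_) hj)
  split_ifs <;> norm_num

theorem countBelow_mul_sub_le (t : ℝ) (j : ι) :
    countBelow U c j * t - costBelow U c j ≤ ∑ j' ∈ U, max (t - c j') 0 := by
  rw [countBelow, costBelow, Finset.sum_mul, ← Finset.sum_sub_distrib]
  refine Finset.sum_le_sum fun j' _ => ?_
  split_ifs
  · rw [one_mul]; exact le_max_left _ _
  · simp

/-- The linear piece active at `t` is that of the most expensive city with cost at most `t`. With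
the previous bound, a positive offer is the maximum of its linear pieces. -/
theorem exists_countBelow_mul_sub_eq {t : ℝ} (h : 0 < ∑ j' ∈ U, max (t - c j') 0) :
    ∃ j ∈ U, countBelow U c j * t - costBelow U c j = ∑ j' ∈ U, max (t - c j') 0 := by
  obtain ⟨j₀, hj₀, hpos⟩ := Finset.exists_lt_of_sum_lt (f := fun _ => (0 : ℝ)) (by simpa using h)
  have hj₀t : c j₀ ≤ t := by
    by_contra! hlt
    exact hpos.ne (max_eq_right (by linarith)).symm
  obtain ⟨j, hj, hmax⟩ := Finset.exists_max_image (U.filter fun j => c j ≤ t) c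
    ⟨j₀, by simp [hj₀, hj₀t]⟩
  rw [Finset.mem_filter] at hj
  refine ⟨j, hj.1, ?_⟩
  rw [countBelow, costBelow, Finset.sum_mul, ← Finset.sum_sub_distrib]
  refine Finset.sum_congr rfl fun j' hj' => ?_
  by_cases hle : c j' ≤ c j
  · rw [if_pos hle, if_pos hle, one_mul, max_eq_left (by linarith [hj.2])]
  · have : t < c j' := by
      by_contra! h'
      exact hle (hmax j' (by simp [hj', h']))
    rw [if_neg hle, if_neg hle, max_eq_right (by linarith)]; simp

end Threshold

namespace State

variable {I : Instance}

/-- The unconnected cities. -/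
def unconnected (s : State I) : Finset (Fin I.nc) := Finset.univ.filter fun j => s.conn j = none

@[simp] theorem mem_unconnected {s : State I} {j : Fin I.nc} :
    j ∈ s.unconnected ↔ s.conn j = none := by simp [unconnected]

/-- The total offer of the connected cities to a facility. -/
noncomputable def savings (s : State I) (i : Fin I.nf) : ℝ :=
  ∑ j, match s.conn j with
    | none => 0
    | some i' => max (I.c i' j - I.c i j) 0

/-- A time assigned to a facility `i` and an unconnected city `j`; the minimum of these is the time
of the next event. -/
noncomputable def dueTime (s : State I) (i : Fin I.nf) (j : Fin I.nc) : ℝ :=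
  open Classical in
  if i ∈ s.opened then I.c i j else if I.f i ≤ s.savings i then s.time else
    (I.f i - s.savings i + costBelow s.unconnected (I.c i) j) /
      countBelow s.unconnected (I.c i) j

theorem Inv.sum_offer_raise {s : State I} (h : s.Inv) (t : ℝ) (i : Fin I.nf) :
    ∑ j, (s.raise t).offer i j = s.savings i + ∑ j ∈ s.unconnected, max (t - I.c i j) 0 := by
  rw [unconnected, Finset.sum_filter, savings, ← Finset.sum_add_distrib]
  refine Finset.sum_congr rfl fun j _ => ?_
  cases hj : s.conn j with
  | none => rw [h.raise_offer_of_none hj]; simp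
  | some i' => rw [raise_offer_of_some hj]; simp

/-- A maximum of increasing linear functions first reaches a level at the least of the times at
which the individual functions reach it. Hence minimizing over cities gives the opening time of each
facility, and minimizing over facilities gives the next event. -/
theorem Inv.nextEventTime_dueTime {s : State I} (h : s.Inv) {i₀ : Fin I.nf} {j₀ : Fin I.nc}
    (hj₀ : s.conn j₀ = none)
    (hmin : ∀ i j, s.conn j = none → s.dueTime i₀ j₀ ≤ s.dueTime i j) :
    s.NextEventTime (s.dueTime i₀ j₀) ∧
      (i₀ ∈ s.opened → (s.raise (s.dueTime i₀ j₀)).CanConnect i₀ j₀) ∧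
      (i₀ ∉ s.opened → (s.raise (s.dueTime i₀ j₀)).CanOpen i₀) := by
  have hopen : ∀ {i j}, i ∈ s.opened → s.dueTime i j = I.c i j := fun hi => if_pos hi
  have hnow : ∀ {i j}, i ∉ s.opened → I.f i ≤ s.savings i → s.dueTime i j = s.time := by
    intro i j hi hf; rw [dueTime, if_neg hi, if_pos hf]
  have hlater : ∀ {i j}, i ∉ s.opened → s.savings i < I.f i → s.dueTime i j =
      (I.f i - s.savings i + costBelow s.unconnected (I.c i) j) /
        countBelow s.unconnected (I.c i) j := by
    intro i j hi hf; rw [dueTime, if_neg hi, if_neg hf.not_ge]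
  have hle : ∀ {i}, i ∉ s.opened →
      s.savings i + ∑ j ∈ s.unconnected, max (s.time - I.c i j) 0 ≤ I.f i := by
    intro i hi
    rw [← h.sum_offer_raise, h.raise_time_eq]; exact h.offers_le hi
  have hpos : ∀ (i : Fin I.nf) (t : ℝ), 0 ≤ ∑ j ∈ s.unconnected, max (t - I.c i j) 0 :=
    fun i t => Finset.sum_nonneg fun _ _ => le_max_right _ _
  have hge : ∀ i j, s.conn j = none → s.time ≤ s.dueTime i j := by
    intro i j hj
    by_cases hi : i ∈ s.opened
    · rw [hopen hi]; exact h.le_c hj hi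
    · rcases le_or_gt (I.f i) (s.savings i) with hf | hf
      · rw [hnow hi hf]
      · have h1 := one_le_countBelow (c := I.c i) (mem_unconnected.2 hj)
        have h2 := countBelow_mul_sub_le (U := s.unconnected) (c := I.c i) s.time j
        rw [hlater hi hf, le_div_iff₀ (by linarith)]
        linarith [hle hi]
  set t := s.dueTime i₀ j₀ with ht
  have hcan : i₀ ∈ s.opened → (s.raise t).CanConnect i₀ j₀ := by
    intro hi
    refine ⟨hi, hj₀, ?_⟩
    rw [h.raise_α hj₀, ht, hopen hi]
  have hcan' : i₀ ∉ s.opened → (s.raise t).CanOpen i₀ := by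
    intro hi
    refine ⟨hi, ?_⟩
    rw [h.sum_offer_raise]
    rcases le_or_gt (I.f i₀) (s.savings i₀) with hf | hf
    · rw [ht, hnow hi hf]
      exact le_antisymm (hle hi) (by linarith [hpos i₀ s.time])
    · refine le_antisymm ?_ ?_
      -- Were the offer too large at `t`, the piece active there would have reached the level before
      -- `t`, against minimality.
      · by_contra! hlt
        obtain ⟨j, hj, hjeq⟩ := exists_countBelow_mul_sub_eq (U := s.unconnected) (c := I.c i₀)
          (t := t) (by linarith)
        have h1 := one_le_countBelow (c := I.c i₀) hj
        have h2 := hmin i₀ j (mem_unconnected.1 hj)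
        rw [hlater hi hf, le_div_iff₀ (by linarith)] at h2
        linarith
      · have h1 := one_le_countBelow (c := I.c i₀) (mem_unconnected.2 hj₀)
        have h2 := countBelow_mul_sub_le (U := s.unconnected) (c := I.c i₀) t j₀
        have h3 : t * countBelow s.unconnected (I.c i₀) j₀ =
            I.f i₀ - s.savings i₀ + costBelow s.unconnected (I.c i₀) j₀ := by
          rw [ht, hlater hi hf, div_mul_cancel₀ _ (by linarith)]
        linarith
  refine ⟨⟨⟨j₀, hj₀⟩, hge i₀ j₀ hj₀, ?_, ?_⟩, hcan, hcan'⟩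
  · by_cases hi : i₀ ∈ s.opened
    · exact Or.inr ⟨i₀, j₀, hcan hi⟩
    · exact Or.inl ⟨i₀, hcan' hi⟩
  · rintro u hu hut (⟨i, hi, hsum⟩ | ⟨i, j, hi, hj, hα⟩)
    · have hi : i ∉ s.opened := hi
      rw [h.sum_offer_raise] at hsum
      rcases le_or_gt (I.f i) (s.savings i) with hf | hf
      · have := hmin i j₀ hj₀
        rw [hnow hi hf] at this
        linarith
      · obtain ⟨j, hj, hjeq⟩ := exists_countBelow_mul_sub_eq (U := s.unconnected) (c := I.c i)
          (t := u) (by linarith)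
        have h1 := one_le_countBelow (c := I.c i) hj
        have h2 := hmin i j (mem_unconnected.1 hj)
        have h3 : t * countBelow s.unconnected (I.c i) j ≤
            I.f i - s.savings i + costBelow s.unconnected (I.c i) j := by
          rwa [hlater hi hf, le_div_iff₀ (by linarith)] at h2
        have h4 : u * countBelow s.unconnected (I.c i) j <
            t * countBelow s.unconnected (I.c i) j := mul_lt_mul_of_pos_right hut (by linarith)
        linarith
    · have hj : s.conn j = none := hj
      have h2 := hmin i j hj
      rw [hopen hi] at h2
      rw [h.raise_α hj] at hα
      linarith

end State

end FacilityLocation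

namespace FacilityLocation

/-! ### The program -/

namespace Greedy

open RealRAM LoopProg

/-- The number of facilities. -/
abbrev nF : NExpr := .get 0 (.const 0) (.const 0)

/-- The number of cities. -/
abbrev nC : NExpr := .get 0 (.const 0) (.const 1)

/-- Add `w` times the cost of city `v₁₀` to the sums and `w` to the counts of the pairs
`(v₄, v₅)` with a cost at least as large. -/
def updateCell (w : RExpr) : LoopProg :=
  .ite (.rle (.get 1 (nvar 4) (nvar 10)) (.get 1 (nvar 4) (nvar 5)))
    (.seq
      (.rset 2 (nvar 4) (nvar 5)
        (.add (.get 2 (nvar 4) (nvar 5)) (.mul w (.get 1 (nvar 4) (nvar 10)))))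
      (.rset 3 (nvar 4) (nvar 5) (.add (.get 3 (nvar 4) (nvar 5)) w)))
    .skip

/-- The same for all pairs. -/
def update (w : RExpr) : LoopProg := .loop 4 nF (.loop 5 nC (updateCell w))

/-- Find a city with flag `1`. -/
def findDirty : LoopProg :=
  .seq (.nset 7 (.const 0) (.const 0) (.const 0))
    (.loop 5 nC
      (.ite (.and (.nle (.const 1) (.get 3 (nvar 5) (.const 0)))
          (.nle (.get 3 (nvar 5) (.const 0)) (.const 1)))
        (.seq (.nset 7 (.const 0) (.const 0) (.const 1))
          (.nset 10 (.const 0) (.const 0) (nvar 5)))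
        .skip))

/-- The cost of the connection of city `v₅`. -/
abbrev connCost : RExpr := .get 1 (.get 2 (nvar 5) (.const 0)) (nvar 5)

/-- Compute the total offer of the connected cities to facility `v₄`. -/
def computeSavings : LoopProg :=
  .seq (.rset 5 (.const 0) (.const 0) (.const 0))
    (.loop 5 nC
      (.ite (.and (.nle (.const 1) (.get 3 (nvar 5) (.const 0)))
          (.rle (.get 1 (nvar 4) (nvar 5)) connCost))
        (.rset 5 (.const 0) (.const 0)
          (.add (rvar 5) (.sub connCost (.get 1 (nvar 4) (nvar 5)))))
        .skip))

/-- Compute the time assigned to facility `v₄` and the unconnected city `v₅`. -/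
def computeDue : LoopProg :=
  .ite (.nle (.const 1) (.get 1 (nvar 4) (.const 0)))
    (.rset 6 (.const 0) (.const 0) (.get 1 (nvar 4) (nvar 5)))
    (.ite (.rle (.get 0 (nvar 4) (.const 0)) (rvar 5))
      (.rset 6 (.const 0) (.const 0) (rvar 4))
      (.rset 6 (.const 0) (.const 0)
        (.div (.add (.sub (.get 0 (nvar 4) (.const 0)) (rvar 5)) (.get 2 (nvar 4) (nvar 5)))
          (.get 3 (nvar 4) (nvar 5)))))

/-- Keep the pair `(v₄, v₅)` if its time is the least so far. -/
def record : LoopProg :=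
  .ite (.and (.nle (.const 1) (nvar 7)) (.rle (rvar 7) (rvar 6))) .skip
    (.seq (.rset 7 (.const 0) (.const 0) (rvar 6))
      (.seq (.nset 7 (.const 0) (.const 0) (.const 1))
        (.seq (.nset 8 (.const 0) (.const 0) (nvar 4))
          (.nset 9 (.const 0) (.const 0) (nvar 5)))))

/-- Find the facility and the unconnected city with the least time. -/
def select : LoopProg :=
  .loop 4 nF (.seq computeSavings
    (.loop 5 nC (.ite (.nle (.get 3 (nvar 5) (.const 0)) (.const 0))
      (.seq computeDue record) .skip)))

/-- Connect city `v₅` to facility `v₈` if its offer is nonzero. -/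
def switchCity : LoopProg :=
  .ite (.nle (.get 3 (nvar 5) (.const 0)) (.const 0))
    (.ite (.rle (rvar 4) (.get 1 (nvar 8) (nvar 5))) .skip
      (.seq (.nset 2 (nvar 5) (.const 0) (nvar 8)) (.nset 3 (nvar 5) (.const 0) (.const 1))))
    (.ite (.rle connCost (.get 1 (nvar 8) (nvar 5))) .skip
      (.nset 2 (nvar 5) (.const 0) (nvar 8)))

/-- Open facility `v₈`. -/
def openEvent : LoopProg :=
  .seq (.loop 5 nC switchCity) (.nset 1 (nvar 8) (.const 0) (.const 1))

/-- Connect city `v₉` to facility `v₈`. -/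
def connectEvent : LoopProg :=
  .seq (.nset 3 (nvar 9) (.const 0) (.const 1)) (.nset 2 (nvar 9) (.const 0) (nvar 8))

/-- Process the next event. -/
def event : LoopProg :=
  .ite (.nle (.const 1) (nvar 7))
    (.seq (.rset 4 (.const 0) (.const 0) (rvar 7))
      (.ite (.nle (.const 1) (.get 1 (nvar 8) (.const 0))) connectEvent openEvent))
    .skip

/-- Remove a newly connected city from the sums and counts, or process the next event. -/
def iteration : LoopProg :=
  .seq findDirty
    (.ite (.nle (.const 1) (nvar 7))
      (.seq (update (.sub (.const 0) (.const 1))) (.nset 3 (nvar 10) (.const 0) (.const 2)))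
      (.seq select event))

/-- The algorithm. -/
def main : LoopProg :=
  .seq (.loop 10 nC (update (.const 1))) (.loop 6 (.add nF (.add nC nC)) iteration)

theorem valid_main : main.valid = true := by decide

theorem time_main (n : ℕ) (hn : 1 ≤ n) : main.time n ≤ 10000 * n ^ 3 := by
  have h1 : n ≤ n ^ 3 := Nat.le_self_pow (by norm_num) n
  have h2 : n ^ 2 ≤ n ^ 3 := Nat.pow_le_pow_right hn (by norm_num)
  -- The cubic term comes from n_c initial updates and n_f + 2 n_c rounds, each with two nested
  -- loops.
  have h3 : main.time n = 34 + n * 423 + n ^ 2 * 618 + n ^ 3 * 868 := by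
    simp only [main, iteration, event, connectEvent, openEvent, switchCity, select, record,
      computeDue, computeSavings, findDirty, update, updateCell, LoopProg.time, NExpr.time,
      RExpr.time, Test.time, NExpr.bound]
    ring
  omega

theorem run_updateRow {w : RExpr} {ω : ℝ} (hw : ∀ m, w.eval m = ω) (m : Mem) (i j : ℕ) :
    ((loop 5 nC (updateCell w)).run m).reals 2 i j =
      (if i = m.nats 4 0 0 ∧ j < m.nats 0 0 1 ∧ m.reals 1 i (m.nats 10 0 0) ≤ m.reals 1 i j then
        m.reals 2 i j + ω * m.reals 1 i (m.nats 10 0 0) else m.reals 2 i j) ∧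
    ((loop 5 nC (updateCell w)).run m).reals 3 i j =
      (if i = m.nats 4 0 0 ∧ j < m.nats 0 0 1 ∧ m.reals 1 i (m.nats 10 0 0) ≤ m.reals 1 i j then
        m.reals 3 i j + ω else m.reals 3 i j) := by
  refine run_loop_induction (e := nC) (fun y m' => ∀ i j,
    m'.reals 2 i j = (if i = m.nats 4 0 0 ∧ j < y ∧ m.reals 1 i (m.nats 10 0 0) ≤ m.reals 1 i j
      then m.reals 2 i j + ω * m.reals 1 i (m.nats 10 0 0) else m.reals 2 i j) ∧
    m'.reals 3 i j = (if i = m.nats 4 0 0 ∧ j < y ∧ m.reals 1 i (m.nats 10 0 0) ≤ m.reals 1 i j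
      then m.reals 3 i j + ω else m.reals 3 i j)) ?_ ?_ i j
  · intro i j; simp
  · intro y hy m' hF h5 ih i j
    have e4 := hF.1 4 rfl
    have e10 := hF.1 10 rfl
    have e1 := hF.2 1 rfl
    have ih2 := ih (m.nats 4 0 0) y
    obtain ⟨ih1, ih1'⟩ := ih i j
    simp only [updateCell, run, Test.eval, NExpr.eval, RExpr.eval, Mem.setNat_reals, hw, e4, e10,
      e1, h5]
    by_cases hc : m.reals 1 (m.nats 4 0 0) (m.nats 10 0 0) ≤ m.reals 1 (m.nats 4 0 0) y
    · rw [if_pos hc]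
      simp only [Mem.setReal_reals, Mem.setReal_nats, h5, e4]
      by_cases hij : i = m.nats 4 0 0 ∧ j = y
      · obtain ⟨rfl, rfl⟩ := hij
        simp_all
      · have : i = m.nats 4 0 0 → (j < y + 1 ↔ j < y) := by grind
        grind
    · rw [if_neg hc]
      by_cases hij : i = m.nats 4 0 0 ∧ j = y
      · obtain ⟨rfl, rfl⟩ := hij
        simp_all
      · have : i = m.nats 4 0 0 → (j < y + 1 ↔ j < y) := by grind
        grind

end Greedy

end FacilityLocation

/-! ### What the pieces of the program compute -/

namespace FacilityLocation

namespace Greedy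

open RealRAM LoopProg

theorem run_update {w : RExpr} {ω : ℝ} (hw : ∀ m, w.eval m = ω) (m : Mem) (i j : ℕ) :
    ((update w).run m).reals 2 i j =
      (if i < m.nats 0 0 0 ∧ j < m.nats 0 0 1 ∧ m.reals 1 i (m.nats 10 0 0) ≤ m.reals 1 i j then
        m.reals 2 i j + ω * m.reals 1 i (m.nats 10 0 0) else m.reals 2 i j) ∧
    ((update w).run m).reals 3 i j =
      (if i < m.nats 0 0 0 ∧ j < m.nats 0 0 1 ∧ m.reals 1 i (m.nats 10 0 0) ≤ m.reals 1 i j then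
        m.reals 3 i j + ω else m.reals 3 i j) := by
  refine run_loop_induction (e := nF) (fun x m' => ∀ i j,
    m'.reals 2 i j = (if i < x ∧ j < m.nats 0 0 1 ∧ m.reals 1 i (m.nats 10 0 0) ≤ m.reals 1 i j
      then m.reals 2 i j + ω * m.reals 1 i (m.nats 10 0 0) else m.reals 2 i j) ∧
    m'.reals 3 i j = (if i < x ∧ j < m.nats 0 0 1 ∧ m.reals 1 i (m.nats 10 0 0) ≤ m.reals 1 i j
      then m.reals 3 i j + ω else m.reals 3 i j)) ?_ ?_ i j
  · intro i j; simp
  · intro x _ m' hF h4 ih i j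
    have e0 := hF.1 0 rfl
    have e10 := hF.1 10 rfl
    have e1 := hF.2 1 rfl
    obtain ⟨r2, r3⟩ := run_updateRow hw m' i j
    obtain ⟨ih2, ih3⟩ := ih i j
    simp only [Mem.setNat_reals, r2, r3, h4, e0, e10, e1]
    by_cases hi : i = x
    · subst hi; simp_all
    · have : i < x + 1 ↔ i < x := by omega
      simp_all

theorem run_findDirty (m : Mem) :
    ((findDirty.run m).nats 7 0 0 = 0 ∧ ∀ j < m.nats 0 0 1, m.nats 3 j 0 ≠ 1) ∨
    ((findDirty.run m).nats 7 0 0 = 1 ∧ (findDirty.run m).nats 10 0 0 < m.nats 0 0 1 ∧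
      m.nats 3 ((findDirty.run m).nats 10 0 0) 0 = 1) := by
  rw [findDirty, run]
  set m₀ := (nset 7 (.const 0) (.const 0) (.const 0)).run m with hm₀
  have h0 : m₀.nats 0 = m.nats 0 := run_nats rfl m
  have h3 : m₀.nats 3 = m.nats 3 := run_nats rfl m
  have h7 : m₀.nats 7 0 0 = 0 := by simp [hm₀, run, NExpr.eval, Mem.setNat_nats]
  have hE : nC.eval m₀ = m.nats 0 0 1 := by simp [NExpr.eval, h0]
  rw [← hE]
  refine run_loop_induction (fun y m' =>
    (m'.nats 7 0 0 = 0 ∧ ∀ j < y, m.nats 3 j 0 ≠ 1) ∨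
      (m'.nats 7 0 0 = 1 ∧ m'.nats 10 0 0 < nC.eval m₀ ∧ m.nats 3 (m'.nats 10 0 0) 0 = 1)) ?_ ?_
  · exact Or.inl ⟨by simp [Mem.setNat_nats, h7], by simp⟩
  · intro y hy m' hF h5 ih
    have e3 := (hF.1 3 rfl).trans h3
    by_cases hc : 1 ≤ m.nats 3 y 0 ∧ m.nats 3 y 0 ≤ 1
    · right
      simp only [run, Test.eval, NExpr.eval, h5, e3, hc, and_self, if_true]
      simp only [NExpr.eval] at hy
      simp [Mem.setNat_nats, hy, h5]
      omega
    · simp only [run, Test.eval, NExpr.eval, h5, e3, hc, if_false]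
      have h1 : ∀ a ≠ 5, (m'.setNat 5 0 0 (y + 1)).nats a = m'.nats a :=
        fun a ha => Mem.setNat_nats_of_ne _ ha _ _ _
      rw [h1 7 (by norm_num), h1 10 (by norm_num)]
      refine ih.imp (fun h => ⟨h.1, fun j hj => ?_⟩) id
      rcases Nat.lt_succ_iff_lt_or_eq.1 hj with hj | rfl
      · exact h.2 j hj
      · omega

/-- The total offer of the connected cities to facility `i`, read off from the memory. -/
noncomputable def memSavings (m : Mem) (i : ℕ) : ℝ :=
  ∑ j ∈ Finset.range (m.nats 0 0 1),
    if 1 ≤ m.nats 3 j 0 then max (m.reals 1 (m.nats 2 j 0) j - m.reals 1 i j) 0 else 0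

theorem run_computeSavings (m : Mem) :
    (computeSavings.run m).reals 5 0 0 = memSavings m (m.nats 4 0 0) := by
  rw [computeSavings, run]
  set m₀ := (rset 5 (.const 0) (.const 0) (.const 0)).run m with hm₀
  have hn : m₀.nats = m.nats := rfl
  have h1 : m₀.reals 1 = m.reals 1 := run_reals rfl m
  have h5 : m₀.reals 5 0 0 = 0 := by simp [hm₀, run, NExpr.eval, RExpr.eval, Mem.setReal_reals]
  have hE : nC.eval m₀ = m.nats 0 0 1 := by simp [NExpr.eval, hn]
  rw [memSavings, ← hE]
  refine run_loop_induction (fun y m' => m'.reals 5 0 0 = ∑ j ∈ Finset.range y,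
    if 1 ≤ m.nats 3 j 0 then max (m.reals 1 (m.nats 2 j 0) j - m.reals 1 (m.nats 4 0 0) j) 0
    else 0) ?_ ?_
  · simpa using h5
  · intro y hy m' hF hy5 ih
    have e2 := hF.1 2 rfl
    have e3 := hF.1 3 rfl
    have e4 := hF.1 4 rfl
    have e1 := (hF.2 1 rfl).trans h1
    rw [hn] at e2 e3 e4
    rw [Finset.sum_range_succ, Mem.setNat_reals]
    simp only [run, Test.eval, NExpr.eval, RExpr.eval, hy5, e2, e3, e4, e1]
    split_ifs with hc hf hf
    · simp only [Mem.setReal_reals, and_self, if_true, ih]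
      rw [max_eq_left (by linarith [hc.2])]
    · exact absurd hc.1 hf
    · rw [ih, max_eq_right, add_zero]
      by_contra! hlt
      exact hc ⟨hf, by linarith⟩
    · rw [ih, add_zero]

/-- The time assigned to a facility and a city, read off from the memory. -/
noncomputable def memDue (m : Mem) (i j : ℕ) : ℝ :=
  if 1 ≤ m.nats 1 i 0 then m.reals 1 i j else
    if m.reals 0 i 0 ≤ memSavings m i then m.reals 4 0 0 else
      (m.reals 0 i 0 - memSavings m i + m.reals 2 i j) / m.reals 3 i j

theorem run_computeDue {m : Mem} {i j : ℕ} (h4 : m.nats 4 0 0 = i) (h5 : m.nats 5 0 0 = j)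
    (hs : m.reals 5 0 0 = memSavings m i) : (computeDue.run m).reals 6 0 0 = memDue m i j := by
  simp only [computeDue, run, Test.eval, NExpr.eval, RExpr.eval, h4, h5, hs, memDue]
  split_ifs <;> simp [Mem.setReal_reals]

/-- In `m'`, the variables hold a pair from `D` with the least time according to `m`, if there is
such a pair with an unconnected city. -/
def Best (m m' : Mem) (D : ℕ → ℕ → Prop) : Prop :=
  (m'.nats 7 0 0 = 0 ∧ ∀ i j, D i j → m.nats 3 j 0 ≠ 0) ∨
  (m'.nats 7 0 0 = 1 ∧ D (m'.nats 8 0 0) (m'.nats 9 0 0) ∧ m.nats 3 (m'.nats 9 0 0) 0 = 0 ∧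
    m'.reals 7 0 0 = memDue m (m'.nats 8 0 0) (m'.nats 9 0 0) ∧
    ∀ i j, D i j → m.nats 3 j 0 = 0 → m'.reals 7 0 0 ≤ memDue m i j)

theorem Best.congr {m m₁ m₂ : Mem} {D D' : ℕ → ℕ → Prop} (h : Best m m₁ D)
    (h7 : m₂.nats 7 = m₁.nats 7) (h8 : m₂.nats 8 = m₁.nats 8) (h9 : m₂.nats 9 = m₁.nats 9)
    (hr : m₂.reals 7 = m₁.reals 7) (h₁ : ∀ i j, D i j → D' i j)
    (h₂ : ∀ i j, D' i j → D i j ∨ m.nats 3 j 0 ≠ 0) : Best m m₂ D' := by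
  rw [Best, h7, h8, h9, hr]
  rcases h with ⟨a, b⟩ | ⟨a, b, c, d, e⟩
  · exact Or.inl ⟨a, fun i j hD => (h₂ i j hD).elim (b i j) id⟩
  · exact Or.inr ⟨a, h₁ _ _ b, c, d, fun i j hD hj =>
      (h₂ i j hD).elim (fun h => e i j h hj) (fun h => absurd hj h)⟩

theorem Best.record {m m' : Mem} {D : ℕ → ℕ → Prop} (h : Best m m' D) {i j : ℕ}
    (h4 : m'.nats 4 0 0 = i) (h5 : m'.nats 5 0 0 = j) (hj : m.nats 3 j 0 = 0)
    (h6 : m'.reals 6 0 0 = memDue m i j) :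
    Best m (record.run m') fun i' j' => D i' j' ∨ i' = i ∧ j' = j := by
  rw [Greedy.record]
  have hT : Test.eval m' (.and (.nle (.const 1) (nvar 7)) (.rle (rvar 7) (rvar 6))) ↔
      1 ≤ m'.nats 7 0 0 ∧ m'.reals 7 0 0 ≤ m'.reals 6 0 0 := Iff.rfl
  by_cases hc : 1 ≤ m'.nats 7 0 0 ∧ m'.reals 7 0 0 ≤ m'.reals 6 0 0
  · rw [run_ite_pos (hT.2 hc), run]
    rcases h with ⟨a, b⟩ | ⟨a, b, c, d, e⟩
    · omega
    · refine Or.inr ⟨a, Or.inl b, c, d, ?_⟩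
      rintro i' j' (hD | ⟨rfl, rfl⟩) hj'
      · exact e i' j' hD hj'
      · rw [← h6]; exact hc.2
  · rw [run_ite_neg (mt hT.1 hc)]
    simp only [run, NExpr.eval, RExpr.eval]
    refine Or.inr ⟨?_, ?_, ?_, ?_, ?_⟩
    · simp [Mem.setNat_nats]
    · simp [Mem.setNat_nats, h4, h5]
    · simp [Mem.setNat_nats, h5, hj]
    · simp [Mem.setNat_nats, Mem.setReal_reals, h4, h5, h6]
    · rintro i' j' hD hj'
      simp only [Mem.setNat_reals, Mem.setReal_reals, and_self, if_true]
      rcases hD with hD | ⟨rfl, rfl⟩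
      · rcases h with ⟨a, b⟩ | ⟨a, b, c, d, e⟩
        · exact absurd hj' (b i' j' hD)
        · have h7 : ¬ m'.reals 7 0 0 ≤ m'.reals 6 0 0 := fun h7 => hc ⟨a.ge, h7⟩
          exact (not_le.1 h7).le.trans (e i' j' hD hj')
      · exact h6.le

/-- The parts of the memory on which `memSavings` and `memDue` depend agree. -/
def SameData (m m' : Mem) : Prop :=
  m'.nats 0 = m.nats 0 ∧ m'.nats 1 = m.nats 1 ∧ m'.nats 2 = m.nats 2 ∧ m'.nats 3 = m.nats 3 ∧
    m'.reals 0 = m.reals 0 ∧ m'.reals 1 = m.reals 1 ∧ m'.reals 2 = m.reals 2 ∧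
    m'.reals 3 = m.reals 3 ∧ m'.reals 4 = m.reals 4

theorem SameData.trans {m₁ m₂ m₃ : Mem} (h : SameData m₁ m₂) (h' : SameData m₂ m₃) :
    SameData m₁ m₃ := by
  unfold SameData at *
  simp_all

theorem SameData.memSavings_eq {m m' : Mem} (h : SameData m m') :
    memSavings m' = memSavings m := by
  obtain ⟨h0, h1, h2, h3, h4, h5, h6, h7, h8⟩ := h
  funext i
  simp only [memSavings, h0, h2, h3, h5]

theorem SameData.memDue_eq {m m' : Mem} (h : SameData m m') : memDue m' = memDue m := by
  have hs := h.memSavings_eq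
  obtain ⟨h0, h1, h2, h3, h4, h5, h6, h7, h8⟩ := h
  funext i j
  simp only [memDue, hs, h1, h4, h5, h6, h7, h8]

theorem frame_sameData {p : LoopProg} {m m' : Mem} (h : p.Frame m m')
    (hn : (p.keepsNat 0 && p.keepsNat 1 && p.keepsNat 2 && p.keepsNat 3) = true)
    (hr : (p.keepsReal 0 && p.keepsReal 1 && p.keepsReal 2 && p.keepsReal 3 &&
      p.keepsReal 4) = true) : SameData m m' := by
  simp only [Bool.and_eq_true] at hn hr
  exact ⟨h.1 0 hn.1.1.1, h.1 1 hn.1.1.2, h.1 2 hn.1.2, h.1 3 hn.2, h.2 0 hr.1.1.1.1,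
    h.2 1 hr.1.1.1.2, h.2 2 hr.1.1.2, h.2 3 hr.1.2, h.2 4 hr.2⟩

/-- Variable 7 records whether a pair has been found; it must start at 0, as `findDirty` leaves it
when there is no city to remove. -/
theorem run_select {m : Mem} (h7 : m.nats 7 0 0 = 0) :
    Best m (select.run m) fun i j => i < m.nats 0 0 0 ∧ j < m.nats 0 0 1 := by
  refine run_loop_induction (e := nF) (fun x m' => Best m m' fun i j => i < x ∧ j < m.nats 0 0 1)
    ?_ ?_
  · exact Or.inl ⟨by simpa [Mem.setNat_nats] using h7, by simp⟩
  intro x _ m' hF h4 ih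
  have hS : SameData m m' := frame_sameData hF rfl rfl
  rw [run]
  set m₁ := computeSavings.run m' with hm₁
  have hF₁ : computeSavings.Frame m' m₁ := frame_run _ _
  have hS₁ : SameData m m₁ := hS.trans (frame_sameData hF₁ rfl rfl)
  have hs₁ : m₁.reals 5 0 0 = memSavings m x := by
    rw [hm₁, run_computeSavings, h4, hS.memSavings_eq]
  have h4₁ : m₁.nats 4 0 0 = x := by rw [hF₁.1 4 rfl, h4]
  have hB₁ : Best m m₁ fun i j => i < x ∧ j < m.nats 0 0 1 :=
    ih.congr (hF₁.1 7 rfl) (hF₁.1 8 rfl) (hF₁.1 9 rfl) (hF₁.2 7 rfl) (fun _ _ h => h)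
      (fun _ _ h => Or.inl h)
  have hE : nC.eval m₁ = m.nats 0 0 1 := by simp only [NExpr.eval, hS₁.1]
  have key := run_loop_induction (a := 5) (e := nC) (m := m₁)
    (p := .ite (.nle (.get 3 (nvar 5) (.const 0)) (.const 0)) (.seq computeDue record) .skip)
    (fun y m' => Best m m' fun i j => i < x ∧ j < m.nats 0 0 1 ∨ i = x ∧ j < y) ?_ ?_
  · rw [hE] at key
    refine key.congr (Mem.setNat_nats_of_ne _ (by norm_num) _ _ _)
      (Mem.setNat_nats_of_ne _ (by norm_num) _ _ _) (Mem.setNat_nats_of_ne _ (by norm_num) _ _ _)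
      rfl (fun i j h => ?_) (fun i j h => Or.inl ?_) <;> omega
  · exact hB₁.congr (Mem.setNat_nats_of_ne _ (by norm_num) _ _ _)
      (Mem.setNat_nats_of_ne _ (by norm_num) _ _ _) (Mem.setNat_nats_of_ne _ (by norm_num) _ _ _)
      rfl (fun i j h => Or.inl h) (fun i j h => Or.inl (by omega))
  · intro y _ m₂ hF₂ h5 ih₂
    have hS₂ : SameData m m₂ := hS₁.trans (frame_sameData hF₂ rfl rfl)
    have e3 : m₂.nats 3 = m.nats 3 := hS₂.2.2.2.1
    have c7 : ∀ m₃ : Mem, (m₃.setNat 5 0 0 (y + 1)).nats 7 = m₃.nats 7 :=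
      fun m₃ => Mem.setNat_nats_of_ne _ (by norm_num) _ _ _
    have c8 : ∀ m₃ : Mem, (m₃.setNat 5 0 0 (y + 1)).nats 8 = m₃.nats 8 :=
      fun m₃ => Mem.setNat_nats_of_ne _ (by norm_num) _ _ _
    have c9 : ∀ m₃ : Mem, (m₃.setNat 5 0 0 (y + 1)).nats 9 = m₃.nats 9 :=
      fun m₃ => Mem.setNat_nats_of_ne _ (by norm_num) _ _ _
    have hT : Test.eval m₂ (.nle (.get 3 (nvar 5) (.const 0)) (.const 0)) ↔ m.nats 3 y 0 ≤ 0 := by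
      simp only [Test.eval, NExpr.eval, h5, e3]
    by_cases hc : m.nats 3 y 0 ≤ 0
    · rw [run_ite_pos (hT.2 hc), run]
      set m₃ := computeDue.run m₂ with hm₃
      have hF₃ : computeDue.Frame m₂ m₃ := frame_run _ _
      have h4₂ : m₂.nats 4 0 0 = x := by rw [hF₂.1 4 rfl, h4₁]
      have h6 : m₃.reals 6 0 0 = memDue m x y := by
        rw [hm₃, run_computeDue h4₂ h5, hS₂.memDue_eq]
        rw [hF₂.2 5 rfl, hs₁, hS₂.memSavings_eq]
      have hB₃ := ih₂.congr (hF₃.1 7 rfl) (hF₃.1 8 rfl) (hF₃.1 9 rfl) (hF₃.2 7 rfl)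
        (fun _ _ h => h) (fun _ _ h => Or.inl h)
      have hB₄ := hB₃.record ((congrFun₂ (hF₃.1 4 rfl) 0 0).trans h4₂)
        ((congrFun₂ (hF₃.1 5 rfl) 0 0).trans h5) (by omega) h6
      exact hB₄.congr (c7 _) (c8 _) (c9 _) rfl (fun i j h => by omega)
        (fun i j h => Or.inl (by omega))
    · rw [run_ite_neg (mt hT.1 hc), run]
      refine ih₂.congr (c7 _) (c8 _) (c9 _) rfl (fun i j h => by omega) (fun i j h => ?_)
      rcases eq_or_ne j y with rfl | hjy
      · exact Or.inr (by omega)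
      · exact Or.inl (by omega)

theorem run_switchCity {m : Mem} {y : ℕ} (h5 : m.nats 5 0 0 = y) :
    (∀ j, (switchCity.run m).nats 2 j 0 =
      if j = y ∧ (if m.nats 3 y 0 = 0 then m.reals 1 (m.nats 8 0 0) y < m.reals 4 0 0
        else m.reals 1 (m.nats 8 0 0) y < m.reals 1 (m.nats 2 y 0) y)
      then m.nats 8 0 0 else m.nats 2 j 0) ∧
    ∀ j, (switchCity.run m).nats 3 j 0 =
      if j = y ∧ m.nats 3 y 0 = 0 ∧ m.reals 1 (m.nats 8 0 0) y < m.reals 4 0 0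
      then 1 else m.nats 3 j 0 := by
  subst h5
  rw [switchCity]
  by_cases h3 : m.nats 3 (m.nats 5 0 0) 0 = 0
  · rw [run_ite_pos]
    · by_cases hc : m.reals 4 0 0 ≤ m.reals 1 (m.nats 8 0 0) (m.nats 5 0 0)
      · rw [run_ite_pos]
        · simp [run, h3, hc]
        · exact hc
      · rw [run_ite_neg]
        · simp [run, NExpr.eval, Mem.setNat_nats, h3, not_le.1 hc]
        · exact hc
    · exact h3.le
  · rw [run_ite_neg]
    · by_cases hc : m.reals 1 (m.nats 2 (m.nats 5 0 0) 0) (m.nats 5 0 0) ≤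
          m.reals 1 (m.nats 8 0 0) (m.nats 5 0 0)
      · rw [run_ite_pos]
        · simp [run, h3, hc]
        · exact hc
      · rw [run_ite_neg]
        · simp [run, NExpr.eval, Mem.setNat_nats, h3, not_le.1 hc]
        · exact hc
    · exact fun h => h3 (Nat.le_zero.1 h)

theorem run_openEvent (m : Mem) :
    (∀ i, (openEvent.run m).nats 1 i 0 = if i = m.nats 8 0 0 then 1 else m.nats 1 i 0) ∧
    (∀ j, (openEvent.run m).nats 2 j 0 =
      if j < m.nats 0 0 1 ∧ (if m.nats 3 j 0 = 0 then m.reals 1 (m.nats 8 0 0) j < m.reals 4 0 0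
        else m.reals 1 (m.nats 8 0 0) j < m.reals 1 (m.nats 2 j 0) j)
      then m.nats 8 0 0 else m.nats 2 j 0) ∧
    ∀ j, (openEvent.run m).nats 3 j 0 =
      if j < m.nats 0 0 1 ∧ m.nats 3 j 0 = 0 ∧ m.reals 1 (m.nats 8 0 0) j < m.reals 4 0 0
      then 1 else m.nats 3 j 0 := by
  rw [openEvent, run]
  have key := run_loop_induction (a := 5) (e := nC) (m := m) (p := switchCity)
    (fun y m' => (∀ j, m'.nats 2 j 0 =
      if j < y ∧ (if m.nats 3 j 0 = 0 then m.reals 1 (m.nats 8 0 0) j < m.reals 4 0 0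
        else m.reals 1 (m.nats 8 0 0) j < m.reals 1 (m.nats 2 j 0) j)
      then m.nats 8 0 0 else m.nats 2 j 0) ∧
      ∀ j, m'.nats 3 j 0 =
      if j < y ∧ m.nats 3 j 0 = 0 ∧ m.reals 1 (m.nats 8 0 0) j < m.reals 4 0 0
      then 1 else m.nats 3 j 0) ?_ ?_
  · have hF := frame_run (loop 5 nC switchCity) m
    set m₁ := (loop 5 nC switchCity).run m
    have e1 := hF.1 1 rfl
    have e8 := hF.1 8 rfl
    simp only [run, NExpr.eval]
    refine ⟨fun i => ?_, fun j => ?_, fun j => ?_⟩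
    · simp [Mem.setNat_nats, e1, e8]
    · rw [Mem.setNat_nats_of_ne _ (by norm_num)]; exact key.1 j
    · rw [Mem.setNat_nats_of_ne _ (by norm_num)]; exact key.2 j
  · refine ⟨fun j => ?_, fun j => ?_⟩
    · rw [Mem.setNat_nats_of_ne _ (by norm_num)]; simp
    · rw [Mem.setNat_nats_of_ne _ (by norm_num)]; simp
  · rintro y hy m' hF h5 ⟨ih2, ih3⟩
    have e8 := hF.1 8 rfl
    have er := hF.2 1 rfl
    have e4 := hF.2 4 rfl
    have y2 : m'.nats 2 y 0 = m.nats 2 y 0 := by rw [ih2]; simp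
    have y3 : m'.nats 3 y 0 = m.nats 3 y 0 := by rw [ih3]; simp
    obtain ⟨r2, r3⟩ := run_switchCity h5
    simp only [y2, y3, e8, er, e4] at r2 r3
    have hlt : ∀ j, j ≠ y → (j < y + 1 ↔ j < y) := fun j hj => by omega
    refine ⟨fun j => ?_, fun j => ?_⟩
    · rw [Mem.setNat_nats_of_ne _ (by norm_num), r2]
      rcases eq_or_ne j y with rfl | hne
      · simp only [true_and, Nat.lt_succ_self, y2]
      · simp only [hne, false_and, if_false, hlt j hne]; exact ih2 j
    · rw [Mem.setNat_nats_of_ne _ (by norm_num), r3]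
      rcases eq_or_ne j y with rfl | hne
      · simp only [true_and, Nat.lt_succ_self, y3]
      · simp only [hne, false_and, if_false, hlt j hne]; exact ih3 j

end Greedy

end FacilityLocation

/-! ### The memory follows an execution of the algorithm -/

namespace FacilityLocation

theorem costBelow_insert {ι : Type*} [DecidableEq ι] {U : Finset ι} {a : ι} (ha : a ∉ U)
    (c : ι → ℝ) (j : ι) :
    costBelow (insert a U) c j = costBelow U c j + if c a ≤ c j then c a else 0 := by
  rw [costBelow, Finset.sum_insert ha, add_comm, costBelow]

theorem countBelow_insert {ι : Type*} [DecidableEq ι] {U : Finset ι} {a : ι} (ha : a ∉ U)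
    (c : ι → ℝ) (j : ι) :
    countBelow (insert a U) c j = countBelow U c j + if c a ≤ c j then 1 else 0 := by
  rw [countBelow, Finset.sum_insert ha, add_comm, countBelow]

namespace State

variable {I : Instance}

theorem Inv.offer_ne_zero_of_none {s : State I} (h : s.Inv) {j : Fin I.nc} (hj : s.conn j = none)
    {i : Fin I.nf} : s.offer i j ≠ 0 ↔ I.c i j < s.time := by
  rw [offer_of_none hj, h.α_eq hj, Ne, max_eq_right_iff, not_le, sub_pos]

theorem offer_ne_zero_of_some {s : State I} {j : Fin I.nc} {i i' : Fin I.nf}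
    (hj : s.conn j = some i') : s.offer i j ≠ 0 ↔ I.c i j < I.c i' j := by
  rw [offer_of_some hj, Ne, max_eq_right_iff, not_le, sub_pos]

end State

namespace Greedy

open RealRAM LoopProg

variable {I : Instance}

/-- The memory `m` contains the input data. -/
structure HasInput (I : Instance) (m : Mem) : Prop where
  nf : m.nats 0 0 0 = I.nf
  nc : m.nats 0 0 1 = I.nc
  f : ∀ i : Fin I.nf, m.reals 0 i 0 = I.f i
  c : ∀ (i : Fin I.nf) (j : Fin I.nc), m.reals 1 i j = I.c i j

theorem hasInput_load (I : Instance) : HasInput I I.load where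
  nf := by simp [Instance.load]
  nc := by simp [Instance.load]
  f := by simp [Instance.load]
  c := by simp [Instance.load]

theorem HasInput.congr {m m' : Mem} (h : HasInput I m) (h0 : m'.nats 0 = m.nats 0)
    (hf : m'.reals 0 = m.reals 0) (hc : m'.reals 1 = m.reals 1) : HasInput I m' where
  nf := by rw [h0, h.nf]
  nc := by rw [h0, h.nc]
  f := by rw [hf]; exact h.f
  c := by rw [hc]; exact h.c

theorem HasInput.run_update {m : Mem} (h : HasInput I m) {w : RExpr} {ω : ℝ}
    (hw : ∀ m, w.eval m = ω) {a : Fin I.nc} (ha : m.nats 10 0 0 = a) (i : Fin I.nf)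
    (j : Fin I.nc) :
    ((update w).run m).reals 2 i j =
      m.reals 2 i j + ω * (if I.c i a ≤ I.c i j then I.c i a else 0) ∧
    ((update w).run m).reals 3 i j =
      m.reals 3 i j + ω * (if I.c i a ≤ I.c i j then 1 else 0) := by
  obtain ⟨h2, h3⟩ := Greedy.run_update hw m i j
  rw [h2, h3, h.nf, h.nc, ha, h.c, h.c]
  simp only [i.2, j.2, true_and]
  split_ifs <;> simp

/-- The cities whose costs are included in the sums and counts. -/
def live (I : Instance) (m : Mem) : Finset (Fin I.nc) :=
  Finset.univ.filter fun j => m.nats 3 j 0 ≠ 2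

/-- The memory `m` contains the configuration `s`. -/
structure Represents (s : State I) (m : Mem) : Prop extends HasInput I m where
  opened : ∀ i : Fin I.nf, m.nats 1 i 0 = if i ∈ s.opened then 1 else 0
  conn_eq_none : ∀ j : Fin I.nc, s.conn j = none ↔ m.nats 3 j 0 = 0
  flag_le : ∀ j : Fin I.nc, m.nats 3 j 0 ≤ 2
  conn_eq_some : ∀ {j : Fin I.nc} {i : Fin I.nf}, s.conn j = some i → m.nats 2 j 0 = i
  time : m.reals 4 0 0 = s.time
  sum : ∀ (i : Fin I.nf) (j : Fin I.nc), m.reals 2 i j = costBelow (live I m) (I.c i) j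
  count : ∀ (i : Fin I.nf) (j : Fin I.nc), m.reals 3 i j = countBelow (live I m) (I.c i) j

theorem Represents.congr {s : State I} {m m' : Mem} (h : Represents s m) (hS : SameData m m') :
    Represents s m' := by
  obtain ⟨n0, n1, n2, n3, r0, r1, r2, r3, r4⟩ := hS
  have hl : live I m' = live I m := by simp only [live, n3]
  refine ⟨h.toHasInput.congr n0 r0 r1, ?_, ?_, ?_, ?_, ?_, ?_, ?_⟩
  · rw [n1]; exact h.opened
  · rw [n3]; exact h.conn_eq_none
  · rw [n3]; exact h.flag_le
  · rw [n2]; exact h.conn_eq_some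
  · rw [r4]; exact h.time
  · rw [r2, hl]; exact h.sum
  · rw [r3, hl]; exact h.count

theorem represents_init (I : Instance) :
    Represents (State.init I) ((loop 10 nC (update (.const 1))).run I.load) := by
  have hF := frame_run (loop 10 nC (update (.const 1))) I.load
  have key := run_loop_induction (a := 10) (e := nC) (m := I.load) (p := update (.const 1))
    (fun q m' => ∀ (i : Fin I.nf) (j : Fin I.nc),
      m'.reals 2 i j = costBelow (Finset.univ.filter fun a : Fin I.nc => (a : ℕ) < q) (I.c i) j ∧
      m'.reals 3 i j = countBelow (Finset.univ.filter fun a : Fin I.nc => (a : ℕ) < q) (I.c i) j)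
    ?_ ?_
  · set m := (loop 10 nC (update (.const 1))).run I.load
    have hE : nC.eval I.load = I.nc := (hasInput_load I).nc
    have h3 : ∀ j, m.nats 3 j 0 = 0 := fun j => by rw [hF.1 3 rfl]; simp [Instance.load]
    have hl : live I m = Finset.univ.filter fun a : Fin I.nc => (a : ℕ) < nC.eval I.load := by
      simp [live, h3, hE]
    refine ⟨(hasInput_load I).congr (hF.1 0 rfl) (hF.2 0 rfl) (hF.2 1 rfl), ?_, ?_, ?_, ?_, ?_,
      ?_, ?_⟩
    · intro i; rw [hF.1 1 rfl]; simp [Instance.load, State.init]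
    · intro j; simp [h3, State.init]
    · intro j; simp [h3]
    · intro j i hj; simp [State.init] at hj
    · rw [hF.2 4 rfl]; simp [Instance.load, State.init]
    · intro i j; rw [hl]; exact (key i j).1
    · intro i j; rw [hl]; exact (key i j).2
  · intro i j
    simp [Instance.load, costBelow, countBelow]
  · intro q hq m' hF' h10 ih i j
    have hm' : HasInput I m' :=
      (hasInput_load I).congr (hF'.1 0 rfl) (hF'.2 0 rfl) (hF'.2 1 rfl)
    have hq : q < I.nc := lt_of_lt_of_eq hq (hasInput_load I).nc
    obtain ⟨h2, h3⟩ := hm'.run_update (w := .const 1) (ω := 1) (fun _ => by simp [RExpr.eval])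
      (a := ⟨q, hq⟩) h10 i j
    have hins : (Finset.univ.filter fun a : Fin I.nc => (a : ℕ) < q + 1) =
        insert ⟨q, hq⟩ (Finset.univ.filter fun a : Fin I.nc => (a : ℕ) < q) := by
      ext a
      simp only [Finset.mem_filter, Finset.mem_univ, true_and, Finset.mem_insert, Fin.ext_iff]
      omega
    rw [hins, costBelow_insert (by simp), countBelow_insert (by simp), Mem.setNat_reals, h2, h3,
      (ih i j).1, (ih i j).2, one_mul, one_mul]
    exact ⟨rfl, rfl⟩

/-- Removing a connected city from the sums and counts. -/
theorem Represents.remove {s : State I} {m : Mem} (h : Represents s m) {a : Fin I.nc}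
    (ha : m.nats 10 0 0 = a) (h1 : m.nats 3 a 0 = 1) :
    Represents s ((seq (update (.sub (.const 0) (.const 1)))
      (.nset 3 (nvar 10) (.const 0) (.const 2))).run m) := by
  have hF := frame_run (update (.sub (.const 0) (.const 1))) m
  have hU := h.toHasInput.run_update (w := .sub (.const 0) (.const 1)) (ω := -1)
    (fun _ => by simp [RExpr.eval]) ha
  simp only [run, NExpr.eval]
  set m₁ := (update (.sub (.const 0) (.const 1))).run m
  have e10 : m₁.nats 10 0 0 = a := by rw [hF.1 10 rfl, ha]
  rw [e10]
  have h3 : ∀ j : Fin I.nc, (m₁.setNat 3 a 0 2).nats 3 j 0 = if j = a then 2 else m.nats 3 j 0 := by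
    intro j; simp [Mem.setNat_nats, hF.1 3 rfl, Fin.ext_iff]
  have hne : ∀ b ≠ 3, (m₁.setNat 3 a 0 2).nats b = m₁.nats b :=
    fun b hb => Mem.setNat_nats_of_ne _ hb _ _ _
  have hl : live I m = insert a (live I (m₁.setNat 3 a 0 2)) := by
    ext j
    simp only [live, Finset.mem_filter, Finset.mem_univ, true_and, Finset.mem_insert, h3]
    split_ifs with hj
    · subst hj; simp [h1]
    · simp [hj]
  have hnot : a ∉ live I (m₁.setNat 3 a 0 2) := by simp [live, h3]
  refine ⟨h.toHasInput.congr ((hne 0 (by norm_num)).trans (hF.1 0 rfl)) (hF.2 0 rfl)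
    (hF.2 1 rfl), ?_, ?_, ?_, ?_, ?_, ?_, ?_⟩
  · rw [hne 1 (by norm_num), hF.1 1 rfl]; exact h.opened
  · intro j
    rw [h3, h.conn_eq_none]
    split_ifs with hj
    · subst hj; simp [h1]
    · rfl
  · intro j
    rw [h3]
    split_ifs
    · exact le_rfl
    · exact h.flag_le j
  · rw [hne 2 (by norm_num), hF.1 2 rfl]; exact h.conn_eq_some
  · rw [Mem.setNat_reals, hF.2 4 rfl]; exact h.time
  · intro i j
    rw [Mem.setNat_reals, (hU i j).1, h.sum, hl, costBelow_insert hnot]; ring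
  · intro i j
    rw [Mem.setNat_reals, (hU i j).2, h.count, hl, countBelow_insert hnot]; ring

/-- Flag 0 means unconnected, 1 connected but still counted in the tables, 2 connected and removed
from them. -/
theorem Represents.live_eq {s : State I} {m : Mem} (h : Represents s m)
    (h1 : ∀ j : Fin I.nc, m.nats 3 j 0 ≠ 1) : live I m = s.unconnected := by
  ext j
  have := h.flag_le j
  have := h1 j
  simp only [live, Finset.mem_filter, Finset.mem_univ, true_and, State.mem_unconnected,
    h.conn_eq_none]
  omega

theorem Represents.memSavings_eq {s : State I} {m : Mem} (h : Represents s m) (i : Fin I.nf) :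
    memSavings m i = s.savings i := by
  rw [memSavings, h.nc, Finset.sum_range, State.savings]
  refine Finset.sum_congr rfl fun j _ => ?_
  cases hj : s.conn j with
  | none => simp [(h.conn_eq_none j).1 hj]
  | some i' =>
    have h0 : m.nats 3 j 0 ≠ 0 := fun h0 => by simp [(h.conn_eq_none j).2 h0] at hj
    simp only [h.conn_eq_some hj, h.c]
    rw [if_pos (Nat.one_le_iff_ne_zero.2 h0)]

theorem Represents.memDue_eq {s : State I} {m : Mem} (h : Represents s m)
    (h1 : ∀ j : Fin I.nc, m.nats 3 j 0 ≠ 1) (i : Fin I.nf) (j : Fin I.nc) :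
    memDue m i j = s.dueTime i j := by
  rw [memDue, State.dueTime, h.memSavings_eq, h.opened, h.c, h.f, h.time, h.sum, h.count,
    h.live_eq h1]
  by_cases hi : i ∈ s.opened
  · simp [hi]
  · simp [hi]

theorem Represents.raise {s : State I} {m : Mem} (h : Represents s m) (t : ℝ) :
    Represents (s.raise t) (m.setReal 4 0 0 t) := by
  have hr : ∀ a ≠ 4, (m.setReal 4 0 0 t).reals a = m.reals a :=
    fun a ha => Mem.setReal_reals_of_ne _ ha _ _ _
  refine ⟨h.toHasInput.congr rfl (hr 0 (by norm_num)) (hr 1 (by norm_num)), h.opened,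
    h.conn_eq_none, h.flag_le, h.conn_eq_some, ?_, ?_, ?_⟩
  · simp [Mem.setReal_reals]
  · rw [hr 2 (by norm_num)]; exact h.sum
  · rw [hr 3 (by norm_num)]; exact h.count

theorem Represents.connect {s : State I} {m : Mem} (h : Represents s m) {i₀ : Fin I.nf}
    {j₀ : Fin I.nc} (h8 : m.nats 8 0 0 = i₀) (h9 : m.nats 9 0 0 = j₀) (hj : s.conn j₀ = none) :
    Represents (s.connect i₀ j₀) (connectEvent.run m) ∧
      live I (connectEvent.run m) = live I m := by
  have hF := frame_run connectEvent m
  have h3 : ∀ j : Fin I.nc, (connectEvent.run m).nats 3 j 0 =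
      if j = j₀ then 1 else m.nats 3 j 0 := by
    intro j; simp [connectEvent, run, NExpr.eval, Mem.setNat_nats, h9, Fin.ext_iff]
  have h2 : ∀ j : Fin I.nc, (connectEvent.run m).nats 2 j 0 =
      if j = j₀ then (i₀ : ℕ) else m.nats 2 j 0 := by
    intro j; simp [connectEvent, run, NExpr.eval, Mem.setNat_nats, h8, h9, Fin.ext_iff]
  have hl : live I (connectEvent.run m) = live I m := by
    ext j
    simp only [live, Finset.mem_filter, Finset.mem_univ, true_and, h3]
    split_ifs with hj'
    · subst hj'; simp [(h.conn_eq_none j).1 hj]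
    · rfl
  refine ⟨⟨h.toHasInput.congr (hF.1 0 rfl) (hF.2 0 rfl) (hF.2 1 rfl), ?_, ?_, ?_, ?_, ?_, ?_,
    ?_⟩, hl⟩
  · rw [hF.1 1 rfl]; exact h.opened
  · intro j
    rw [h3]
    split_ifs with hj'
    · subst hj'; simp [State.connect_conn_self]
    · rw [State.connect_conn_of_ne _ _ hj']; exact h.conn_eq_none j
  · intro j
    rw [h3]
    split_ifs
    · norm_num
    · exact h.flag_le j
  · intro j i hji
    rw [h2]
    split_ifs with hj'
    · subst hj'
      rw [State.connect_conn_self] at hji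
      rw [Option.some.inj hji]
    · rw [State.connect_conn_of_ne _ _ hj'] at hji
      exact h.conn_eq_some hji
  · rw [hF.2 4 rfl]; exact h.time
  · rw [hF.2 2 rfl, hl]; exact h.sum
  · rw [hF.2 3 rfl, hl]; exact h.count

theorem Represents.openFacility {s : State I} {m : Mem} (h : Represents s m) (hs : s.Inv)
    {i₀ : Fin I.nf} (h8 : m.nats 8 0 0 = i₀) :
    Represents (s.openFacility i₀) (openEvent.run m) ∧
      live I (openEvent.run m) = live I m := by
  have hF := frame_run openEvent m
  obtain ⟨r1, r2, r3⟩ := run_openEvent m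
  set m' := openEvent.run m
  have h3 : ∀ j : Fin I.nc, m'.nats 3 j 0 =
      if m.nats 3 j 0 = 0 ∧ I.c i₀ j < s.time then 1 else m.nats 3 j 0 := by
    intro j
    rw [r3, h.nc, h8, h.c, h.time]
    simp only [j.2, true_and]
  have hl : live I m' = live I m := by
    ext j
    simp only [live, Finset.mem_filter, Finset.mem_univ, true_and, h3]
    split_ifs with hj
    · simp [hj.1]
    · rfl
  refine ⟨⟨h.toHasInput.congr (hF.1 0 rfl) (hF.2 0 rfl) (hF.2 1 rfl), ?_, ?_, ?_, ?_, ?_, ?_,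
    ?_⟩, hl⟩
  · intro i
    rw [r1, h8, h.opened, State.openFacility_opened]
    by_cases hi : i = i₀
    · simp [hi]
    · simp [hi, Fin.ext_iff.not.1 hi]
  · intro j
    rw [h3]
    by_cases ho : s.offer i₀ j = 0
    · rw [State.openFacility_conn_of_offer_eq ho, if_neg, h.conn_eq_none]
      rintro ⟨h0, hlt⟩
      exact (hs.offer_ne_zero_of_none ((h.conn_eq_none j).2 h0)).2 hlt ho
    · rw [State.openFacility_conn_of_offer_ne ho]
      split_ifs with hc
      · simp
      · simp only [false_iff]
        exact fun h0 => hc ⟨h0, (hs.offer_ne_zero_of_none ((h.conn_eq_none j).2 h0)).1 ho⟩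
  · intro j
    rw [h3]
    split_ifs
    · norm_num
    · exact h.flag_le j
  · intro j i hji
    rw [r2, h.nc, h8, h.c, h.time]
    simp only [j.2, true_and]
    have hoff : (if m.nats 3 j 0 = 0 then I.c i₀ j < s.time
        else I.c i₀ j < m.reals 1 (m.nats 2 j 0) j) ↔ s.offer i₀ j ≠ 0 := by
      cases hj : s.conn j with
      | none => rw [if_pos ((h.conn_eq_none j).1 hj), hs.offer_ne_zero_of_none hj]
      | some i' =>
        have h0 : m.nats 3 j 0 ≠ 0 := fun h0 => by simp [(h.conn_eq_none j).2 h0] at hj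
        rw [if_neg h0, State.offer_ne_zero_of_some hj, h.conn_eq_some hj, h.c]
    rw [if_congr hoff rfl rfl]
    split_ifs with ho
    · rw [State.openFacility_conn_of_offer_ne ho] at hji
      rw [Option.some.inj hji]
    · rw [State.openFacility_conn_of_offer_eq (not_not.1 ho)] at hji
      exact h.conn_eq_some hji
  · rw [hF.2 4 rfl]; exact h.time
  · rw [hF.2 2 rfl, hl]; exact h.sum
  · rw [hF.2 3 rfl, hl]; exact h.count

/-- If all cities are connected, nothing happens; otherwise the next event is processed. -/
theorem Represents.select_event {s : State I} {m : Mem} (h : Represents s m) (hs : s.Inv)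
    (h7 : m.nats 7 0 0 = 0) (h1 : ∀ j : Fin I.nc, m.nats 3 j 0 ≠ 1) :
    ((∀ j, s.conn j ≠ none) ∧ Represents s ((seq select event).run m)) ∨
      (∃ j, s.conn j = none) ∧ ∃ s', State.Step s s' ∧
        Represents s' ((seq select event).run m) ∧
        live I ((seq select event).run m) = live I m := by
  have hS : SameData m (select.run m) := frame_sameData (frame_run _ _) rfl rfl
  have h₂ := h.congr hS
  have hB := run_select h7
  rw [run, event]
  set m₂ := select.run m
  have hl₂ : live I m₂ = live I m := by simp only [live, hS.2.2.2.1]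
  rcases hB with ⟨b7, hno⟩ | ⟨b7, ⟨hi, hj⟩, hj0, ht, hmin⟩
  · left
    rw [run_ite_neg]
    · refine ⟨fun j hj => ?_, h₂⟩
      exact hno 0 j ⟨by rw [h.nf]; exact I.nf_pos, by rw [h.nc]; exact j.2⟩
        ((h.conn_eq_none j).1 hj)
    · intro hT
      have : 1 ≤ m₂.nats 7 0 0 := hT
      omega
  · right
    rw [h.nf] at hi
    rw [h.nc] at hj
    obtain ⟨i₀, h8⟩ : ∃ i₀ : Fin I.nf, m₂.nats 8 0 0 = i₀ := ⟨⟨_, hi⟩, rfl⟩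
    obtain ⟨j₀, h9⟩ : ∃ j₀ : Fin I.nc, m₂.nats 9 0 0 = j₀ := ⟨⟨_, hj⟩, rfl⟩
    rw [h9] at hj0
    have hj₀ := (h.conn_eq_none j₀).2 hj0
    rw [h8, h9, h.memDue_eq h1] at ht
    obtain ⟨hnext, hconn, hopen⟩ := hs.nextEventTime_dueTime hj₀ fun i j hj => by
      rw [← ht, ← h.memDue_eq h1]
      exact hmin i j ⟨by rw [h.nf]; exact i.2, by rw [h.nc]; exact j.2⟩ ((h.conn_eq_none j).1 hj)
    rw [← ht] at hnext hconn hopen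
    set t := m₂.reals 7 0 0 with htdef
    have h₃ := h₂.raise t
    refine ⟨⟨j₀, hj₀⟩, ?_⟩
    rw [run_ite_pos]
    · have hset : (rset 4 (.const 0) (.const 0) (rvar 7)).run m₂ = m₂.setReal 4 0 0 t := rfl
      rw [run, hset]
      have hl₃ : live I (m₂.setReal 4 0 0 t) = live I m := hl₂
      set m₃ := m₂.setReal 4 0 0 t
      have h8₃ : m₃.nats 8 0 0 = i₀ := h8
      have h9₃ : m₃.nats 9 0 0 = j₀ := h9
      have h1₃ := h₃.opened i₀
      by_cases hio : i₀ ∈ s.opened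
      · rw [run_ite_pos]
        · obtain ⟨hR, hl⟩ := h₃.connect h8₃ h9₃ hj₀
          exact ⟨_, State.Step.connect hnext (hconn hio), hR, hl.trans hl₃⟩
        · change 1 ≤ m₃.nats 1 (m₃.nats 8 0 0) 0
          rw [h8₃, h1₃, if_pos (by exact hio)]
      · rw [run_ite_neg]
        · obtain ⟨hR, hl⟩ := h₃.openFacility (hs.raise hnext) h8₃
          exact ⟨_, State.Step.openFacility hnext (hopen hio), hR, hl.trans hl₃⟩
        · change ¬ 1 ≤ m₃.nats 1 (m₃.nats 8 0 0) 0
          rw [h8₃, h1₃, if_neg (by exact hio)]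
          norm_num
    · exact b7.ge

/-- While a city remains unconnected, the potential `progress` − |`live`| rises in every round: an
event raises `progress` and leaves `live` unchanged, and a removal shrinks `live`. -/
theorem Represents.iteration {s : State I} {m : Mem} {k : ℕ} (h : Represents s m)
    (hs : State.Reached k s) : ∃ (k' : ℕ) (s' : State I), State.Reached k' s' ∧
      Represents s' (iteration.run m) ∧ ((∃ j, s'.conn j = none) → (∃ j, s.conn j = none) ∧
        s.progress + (live I (iteration.run m)).card + 1 ≤ s'.progress + (live I m).card) := by
  have hS : SameData m (findDirty.run m) := frame_sameData (frame_run _ _) rfl rfl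
  have h₁ := h.congr hS
  have hd := run_findDirty m
  rw [Greedy.iteration, run]
  set m₁ := findDirty.run m
  have n3 : m₁.nats 3 = m.nats 3 := hS.2.2.2.1
  have hl₁ : live I m₁ = live I m := by simp only [live, n3]
  rw [← n3, h.nc] at hd
  rcases hd with ⟨h7, hno⟩ | ⟨h7, ha, hf⟩
  · rw [run_ite_neg]
    · rcases h₁.select_event hs.inv h7 fun j => hno j j.2 with ⟨hall, hR⟩ | ⟨hex, s', hst, hR, hl⟩
      · exact ⟨k, s, hs, hR, fun ⟨j, hj⟩ => absurd hj (hall j)⟩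
      · refine ⟨k + 1, s', hs.step hst, hR, fun _ => ⟨hex, ?_⟩⟩
        rw [hl, hl₁]
        have := State.progress_lt_step hst
        omega
    · intro hT
      have : 1 ≤ m₁.nats 7 0 0 := hT
      omega
  · rw [run_ite_pos]
    · obtain ⟨a, ha⟩ : ∃ a : Fin I.nc, m₁.nats 10 0 0 = a := ⟨⟨_, ha⟩, rfl⟩
      rw [ha] at hf
      refine ⟨k, s, hs, h₁.remove ha hf, fun hex => ⟨hex, ?_⟩⟩
      have hF := frame_run (update (.sub (.const 0) (.const 1))) m₁
      have : (live I ((seq (update (.sub (.const 0) (.const 1)))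
          (.nset 3 (nvar 10) (.const 0) (.const 2))).run m₁)).card < (live I m).card := by
        rw [← hl₁]
        simp only [run, NExpr.eval, hF.1 10 rfl, ha]
        refine Finset.card_lt_card ((Finset.ssubset_iff_of_subset fun j => ?_).2 ⟨a, ?_, ?_⟩)
        · simp only [live, Finset.mem_filter, Finset.mem_univ, true_and, Mem.setNat_nats,
            hF.1 3 rfl]
          split_ifs <;> simp
        · simp [live, hf]
        · simp [live, Mem.setNat_nats]
      omega
    · exact h7.ge

theorem main_isOutput (I : Instance) :
    ∃ x : Solution I, x.IsOutput ∧ x.StoredIn (main.run I.load) := by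
  have h₀ := represents_init I
  rw [main, run]
  set m := (loop 10 nC (update (.const 1))).run I.load
  have hE : (NExpr.add nF (.add nC nC)).eval m = I.nf + (I.nc + I.nc) := by
    simp only [NExpr.eval, h₀.nf, h₀.nc]
  have key := run_loop_induction (a := 6) (e := .add nF (.add nC nC)) (m := m) (p := iteration)
    (fun x m' => ∃ (k : ℕ) (s : State I), State.Reached k s ∧ Represents s m' ∧
      ((∃ j, s.conn j = none) → x + (live I m').card ≤ s.progress + I.nc)) ?_ ?_
  · rw [hE] at key
    obtain ⟨k, s, hs, hR, hx⟩ := key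
    set m' := (loop 6 (.add nF (.add nC nC)) iteration).run m
    -- An unconnected city would be live, so the potential inequality would read n_f + 2 n_c + 1 ≤
    -- n_f + 2 n_c.
    have hall : ∀ j, s.conn j ≠ none := by
      intro j hj
      have h1 := hx ⟨j, hj⟩
      have h2 := s.progress_le
      have h3 : 0 < (live I m').card := Finset.card_pos.2 ⟨j, by
        simp [live, (hR.conn_eq_none j).1 hj]⟩
      omega
    choose b hb using fun j => Option.ne_none_iff_exists'.1 (hall j)
    exact ⟨⟨s.opened, b⟩, ⟨k, s, hs, rfl, hb⟩, hR.opened, fun j => hR.conn_eq_some (hb j)⟩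
  · refine ⟨0, State.init I, State.Reached.init, h₀.congr ?_, fun _ => ?_⟩
    -- Resetting the counter is the effect of a loop with no iterations.
    · exact frame_sameData (p := loop 6 (.const 0) .skip) (frame_run _ _) rfl rfl
    · rw [zero_add]
      exact le_add_left (by simpa using Finset.card_le_univ (live I _))
  · rintro x - m' - - ⟨k, s, hs, hR, hx⟩
    obtain ⟨k', s', hs', hR', hx'⟩ := hR.iteration hs
    have hn3 : ((iteration.run m').setNat 6 0 0 (x + 1)).nats 3 = (iteration.run m').nats 3 :=
      Mem.setNat_nats_of_ne _ (by norm_num) _ _ _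
    refine ⟨k', s', hs', hR'.congr ⟨?_, ?_, ?_, hn3, rfl, rfl, rfl, rfl, rfl⟩, fun hex => ?_⟩
    any_goals exact Mem.setNat_nats_of_ne _ (by norm_num) _ _ _
    obtain ⟨hex', hlt⟩ := hx' hex
    have := hx hex'
    have hl : live I ((iteration.run m').setNat 6 0 0 (x + 1)) = live I (iteration.run m') := by
      simp only [live, hn3]
    rw [hl]
    omega

theorem implementedBy_main : ImplementedBy main.compile fun n => 10000 * n ^ 3 := by
  intro I
  obtain ⟨T, hT, hex⟩ := exists_exec valid_main (n := I.size) I.load fun i j => by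
    have h1 : I.nf ≤ I.size := le_max_left _ _
    have h2 : I.nc ≤ I.size := le_max_right _ _
    simp only [Instance.load, true_and]
    split_ifs <;> omega
  obtain ⟨x, hx, hst⟩ := main_isOutput I
  exact ⟨T, _, x, hex, hT.trans (time_main _ (I.nf_pos.trans_le (le_max_left _ _))), hx, hst⟩

end Greedy

end FacilityLocation

theorem mainTheorem1 :
    -- every execution halts, after at most `n_f + n_c` events, with a feasible solution
    (∀ (I : FacilityLocation.Instance) (k : ℕ) (s : FacilityLocation.State I),
      FacilityLocation.State.Reached k s →
        k ≤ I.nf + I.nc ∧ ((∃ j, s.conn j = none) → ∃ s', FacilityLocation.State.Step s s')) ∧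
    (∀ (I : FacilityLocation.Instance) (x : FacilityLocation.Solution I),
      x.IsOutput → x.Feasible) ∧
    -- running time `O(n ^ 3)`
    (∃ (P : RealRAM.Prog) (C : ℕ), FacilityLocation.ImplementedBy P (fun n => C * n ^ 3)) ∧
    -- approximation ratio, however ties are broken
    (∀ A : FacilityLocation.TieBreaking, ∃ ρ : ℝ,
      IsLeast {γ : ℝ | FacilityLocation.IsApproxFactor A.out γ} ρ ∧ 1.598 ≤ ρ ∧ ρ ≤ 1.61) := by
  exact ⟨fun I k s h => ⟨h.le_progress.trans s.progress_le, h.inv.exists_step⟩, fun I x h => h.feasible,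
    ⟨FacilityLocation.Greedy.main.compile, 10000, FacilityLocation.Greedy.implementedBy_main⟩,
    fun A => A.exists_ratio⟩
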